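/- **Theorem.** Let $q$ be a prime power, $A=\mathbb F_q[t]$, $F_\infty=\mathbb F_q((1/t))$ with the absolute value normalised by $|t|=q$, and let $\mathbb C_\infty$ be the completion of an algebraic closure of $F_\infty$. Fix $\xi\in\mathbb C_\infty^\times$. For $s\ge 1$ let $\Omega^s$ be the set of $\omega=(\omega_1,\dots,\omega_s)\in\mathbb C_\infty^s$ with $\omega_s=\xi$ that lie on no $F_\infty$-rational hyperplane $h_1x_1+\dots+h_sx_s=0$. Put $|\omega|=\max_j|\omega_j|$, let $|\omega|_i$ be the infimum of $|h_1\omega_1+\dots+h_s\omega_s|$ over all $h\in F_\infty^s$ with $\max_j|h_j|=1$, and for $n\in\mathbb N$ put $\Omega^s_n=\{\omega\in\Omega^s:|\omega|_i\ge q^{-n}|\omega|\}$. A prime on a product means that zero is omitted. For the lattice $L=A^s\omega=A\omega_1+\dots+A\omega_s$ put $$e_L(x)=x\prod_{\lambda\in L}{}^{'}\Bigl(1-\frac{x}{\lambda}\Bigr),\qquad \varphi^L_a(X)=aX\prod_{\lambda\in a^{-1}L/L}{}^{'}\Bigl(1-\frac{X}{e_L(\lambda)}\Bigr)\quad(a\in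 A),$$ let $\Delta_a(\omega)$ be the leading coefficient of the polynomial $\varphi^{L}_a$, and let $\Delta(\omega)=\Delta_t(\omega)$ be the discriminant of rank $s$. Let $r\ge 2$. For $\omega=(\omega_1,\omega')\in\Omega^r$, so that $\omega'\in\Omega^{r-1}$, put $u=e_{A^{r-1}\omega'}(\omega_1)^{-1}$, and write $\Delta'$ and $\Delta'_a$ for the functions $\Delta$ and $\Delta_a$ of rank $r-1$. For $\omega'\in\Omega^{r-1}$ and nonzero $a\in A$ let $f_a$ be the polynomial $$f_a(X)=X^{q^{(r-1)\deg a}}\,\Delta'_a(\omega')^{-1}\,\varphi_a^{A^{r-1}\omega'}(X^{-1})-1 .$$ Then for every $n\in\mathbb N$ there is $r_n>0$ such that the products $\prod'_{a\in A}(1+f_a(u))$ and $\prod'_{a\in A}(1+f_a(u))^{q^r-1}$ converge uniformly for $(u,\omega')\in B(0,r_n)\times\Omega^{r-1}_n$, where $B(0,r_n)=\{z\in\mathbb C_\infty:|z|<r_n\}$, and such that for every $\omega=(\omega_1,\omega')\in\Omega^r$ with $\omega'\in\Omega^{r-1}_n$ and $|u|<r_n$ $$\Delta(\omega)=-\Delta'(\omega')^q\,u^{q-1}\prod_{a\in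 A}{}^{'}(1+f_a(u))^{q^r-1}.$$ -/

import Mathlib

open Polynomial
open scoped NNReal Topology

noncomputable section

namespace DrinfeldDiscriminant

/-! ### The fields `F_∞ = 𝔽_q((1/t))` and `ℂ_∞` -/

section Fields

variable (Fq : Type*) [Field Fq]

/-- `F_∞`, the completion of `F = 𝔽_q(t)` at the infinite place. -/
abbrev FInf : Type _ := @RatFunc.CompletionAtInfty Fq _ (Classical.decEq _)

/-- The valuation of `F_∞` extends the degree valuation of `F`. -/
theorem FInf.valued_algebraMap (x : RatFunc Fq) (hx : x ≠ 0) :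
    Valued.v (algebraMap (RatFunc Fq) (FInf Fq) x) = WithZero.exp x.intDegree := by
  let _ : DecidableEq (RatFunc Fq) := Classical.decEq _
  let _ := RatFunc.inftyValued Fq
  refine Eq.trans (Valued.extensionValuation_apply_coe (K := RatFunc Fq) x) ?_
  exact RatFunc.inftyValuation_of_nonzero Fq hx

variable [Fintype Fq]

theorem one_lt_card : (1 : ℝ≥0) < (Fintype.card Fq : ℝ≥0) := by
  exact_mod_cast Fintype.one_lt_card

/-- The embedding of the value group of `F_∞` into `ℝ≥0` that sends `exp n` to `q ^ n`. -/
instance FInf.instRankOne :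
    Valuation.RankOne (Valued.v : Valuation (FInf Fq) (WithZero (Multiplicative ℤ))) where
  hom' := (WithZeroMulInt.toNNReal (zero_lt_one.trans (one_lt_card Fq)).ne').comp
    MonoidWithZeroHom.ValueGroup₀.embedding
  strictMono' := (WithZeroMulInt.toNNReal_strictMono (one_lt_card Fq)).comp
    MonoidWithZeroHom.ValueGroup₀.embedding_strictMono
  exists_val_nontrivial := by
    refine ⟨algebraMap (RatFunc Fq) (FInf Fq) RatFunc.X, ?_⟩
    rw [FInf.valued_algebraMap Fq _ RatFunc.X_ne_zero, RatFunc.intDegree_X]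
    exact ⟨WithZero.exp_ne_zero, fun h => by
      rw [← WithZero.exp_zero, WithZero.exp_inj] at h; exact one_ne_zero h⟩

/-- The absolute value of `F_∞`, normalised by `|t| = q`. -/
instance FInf.instNormedField : NormedField (FInf Fq) :=
  Valued.toNormedField (FInf Fq) (WithZero (Multiplicative ℤ))

theorem FInf.norm_algebraMap (x : RatFunc Fq) (hx : x ≠ 0) :
    ‖algebraMap (RatFunc Fq) (FInf Fq) x‖ = (Fintype.card Fq : ℝ) ^ x.intDegree := by
  rw [Valued.toNormedField.norm_def]
  change ((WithZeroMulInt.toNNReal (zero_lt_one.trans (one_lt_card Fq)).ne'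
    (MonoidWithZeroHom.ValueGroup₀.embedding
      (Valued.v.restrict (algebraMap (RatFunc Fq) (FInf Fq) x))) : ℝ≥0) : ℝ) = _
  rw [Valuation.embedding_restrict, FInf.valued_algebraMap Fq x hx,
    WithZeroMulInt.toNNReal_neg_apply _ WithZero.exp_ne_zero]
  simp [WithZero.exp]

instance FInf.instNontriviallyNormedField : NontriviallyNormedField (FInf Fq) where
  non_trivial := by
    refine ⟨algebraMap (RatFunc Fq) (FInf Fq) RatFunc.X, ?_⟩
    rw [FInf.norm_algebraMap Fq _ RatFunc.X_ne_zero, RatFunc.intDegree_X, zpow_one]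
    exact_mod_cast one_lt_card Fq

instance FInf.instIsUltrametricDist : IsUltrametricDist (FInf Fq) :=
  inferInstance

instance FInf.instCompleteSpace : CompleteSpace (FInf Fq) := by
  let _ : DecidableEq (RatFunc Fq) := Classical.decEq _
  let _ := RatFunc.inftyValued Fq
  exact inferInstanceAs (CompleteSpace (UniformSpace.Completion (RatFunc Fq)))

/-- An algebraic closure of `F_∞`. -/
abbrev FInfAlgCl : Type _ := AlgebraicClosure (FInf Fq)

/-- The algebraic closure of `F_∞` with the unique extension of the absolute value. -/
instance FInfAlgCl.instNormedField : NormedField (FInfAlgCl Fq) :=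
  spectralNorm.normedField (FInf Fq) (FInfAlgCl Fq)

instance FInfAlgCl.instNormedAlgebra : NormedAlgebra (FInf Fq) (FInfAlgCl Fq) :=
  spectralNorm.normedAlgebra _ _

instance FInfAlgCl.instIsUltrametricDist : IsUltrametricDist (FInfAlgCl Fq) :=
  IsUltrametricDist.isUltrametricDist_of_forall_norm_add_le_max_norm
    (isNonarchimedean_spectralNorm (K := FInf Fq) (L := FInfAlgCl Fq))

instance FInfAlgCl.instNontriviallyNormedField : NontriviallyNormedField (FInfAlgCl Fq) where
  non_trivial := by
    obtain ⟨x, hx⟩ := NontriviallyNormedField.non_trivial (α := FInf Fq)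
    exact ⟨algebraMap (FInf Fq) (FInfAlgCl Fq) x, by rwa [norm_algebraMap']⟩

instance FInfAlgCl.instUniformContinuousConstSMul :
    UniformContinuousConstSMul (FInf Fq) (FInfAlgCl Fq) :=
  uniformContinuousConstSMul_of_continuousConstSMul _ _

/-- `ℂ_∞`, the completion of an algebraic closure of `F_∞`. -/
abbrev CInf : Type _ := UniformSpace.Completion (FInfAlgCl Fq)

instance CInf.instNontriviallyNormedField : NontriviallyNormedField (CInf Fq) where
  non_trivial := by
    obtain ⟨x, hx⟩ := NontriviallyNormedField.non_trivial (α := FInf Fq)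
    exact ⟨algebraMap (FInf Fq) (CInf Fq) x, by rwa [norm_algebraMap']⟩

instance CInf.instIsUltrametricDist : IsUltrametricDist (CInf Fq) :=
  IsUltrametricDist.of_normedAlgebra (FInf Fq)

/-- The inclusion `A = 𝔽_q[t] → F → F_∞ → ℂ_∞`, which makes `ℂ_∞` an `A`-algebra. -/
instance CInf.instAlgebraPolynomial : Algebra Fq[X] (CInf Fq) :=
  ((algebraMap (FInf Fq) (CInf Fq)).comp
    ((algebraMap (RatFunc Fq) (FInf Fq)).comp (algebraMap Fq[X] (RatFunc Fq)))).toAlgebra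

/-- The absolute value of `ℂ_∞` is normalised by `|a| = q ^ deg a` for nonzero `a ∈ A`. -/
theorem CInf.norm_algebraMap_polynomial (a : Fq[X]) (ha : a ≠ 0) :
    ‖algebraMap Fq[X] (CInf Fq) a‖ = (Fintype.card Fq : ℝ) ^ a.natDegree := by
  have h : algebraMap Fq[X] (CInf Fq) a = algebraMap (FInf Fq) (CInf Fq)
      (algebraMap (RatFunc Fq) (FInf Fq) (algebraMap Fq[X] (RatFunc Fq) a)) := rfl
  rw [h, norm_algebraMap', FInf.norm_algebraMap Fq _ (by simpa using ha),
    RatFunc.intDegree_polynomial, zpow_natCast]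

end Fields

variable {Fq : Type*} [Field Fq] [Fintype Fq]

/-! ### Lattices, exponential functions and Drinfeld modules -/

/-- The `A`-module `A^s ω = A ω₁ + ⋯ + A ω_s` in `ℂ_∞`. -/
def lattice {s : ℕ} (ω : Fin s → CInf Fq) : Submodule Fq[X] (CInf Fq) :=
  Submodule.span Fq[X] (Set.range ω)

/-- The exponential function `e_L(x) = x ∏' (1 - x / l)`, with `l` running through the nonzero
elements of `L`. -/
def latticeExp (L : Submodule Fq[X] (CInf Fq)) (x : CInf Fq) : CInf Fq :=
  x * ∏' l : {l : L // l ≠ 0}, (1 - x / (l : CInf Fq))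

/-- The polynomial `φ_a^L(X) = a X ∏' (1 - X / e_L(z))`, with `z` running through representatives
of the nonzero elements of `a⁻¹L / L`, that is, of the elements of `ℂ_∞ / L` killed by `a`. -/
def drinfeldPoly (L : Submodule Fq[X] (CInf Fq)) (a : Fq[X]) : (CInf Fq)[X] :=
  C (algebraMap Fq[X] (CInf Fq) a) * X *
    ∏ᶠ z : {z : CInf Fq ⧸ L // a • z = 0 ∧ z ≠ 0}, (1 - C (latticeExp L z.1.out)⁻¹ * X)

/-- `Δ_a(ω)`, the leading coefficient of `φ_a` for the lattice `A^s ω`. -/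
def discriminantAt {s : ℕ} (ω : Fin s → CInf Fq) (a : Fq[X]) : CInf Fq :=
  (drinfeldPoly (lattice ω) a).leadingCoeff

/-- The discriminant `Δ(ω) = Δ_t(ω)` of rank `s`. -/
def discriminant {s : ℕ} (ω : Fin s → CInf Fq) : CInf Fq :=
  discriminantAt ω (X : Fq[X])

/-- The polynomial `f_a(X) = X ^ (q ^ (s deg a)) Δ_a(ω)⁻¹ φ_a(X⁻¹) - 1` attached to the lattice
`A^s ω` of rank `s`; `reflect N φ` is `X ^ N φ(X⁻¹)` for a polynomial `φ` of degree at most `N`. -/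
def fPoly {s : ℕ} (ω : Fin s → CInf Fq) (a : Fq[X]) : (CInf Fq)[X] :=
  C (discriminantAt ω a)⁻¹ *
    (drinfeldPoly (lattice ω) a).reflect (Fintype.card Fq ^ (s * a.natDegree)) - 1

/-! ### Drinfeld period domains -/

/-- The Drinfeld period domain `Ω^s`: the points of `ℙ^{s-1}(ℂ_∞)` outside all `F_∞`-rational
hyperplanes, represented by the column vectors with last entry `ξ`. -/
def periodDomain (ξ : CInf Fq) (s : ℕ) : Set (Fin s → CInf Fq) :=
  {ω | (∀ i : Fin s, (i : ℕ) + 1 = s → ω i = ξ) ∧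
    ∀ h : Fin s → FInf Fq, h ≠ 0 → ∑ j, h j • ω j ≠ 0}

/-- `|ω|_i`, the infimum of `|h₁ ω₁ + ⋯ + h_s ω_s|` over all `F_∞`-rational hyperplanes, where the
coefficients are normalised by `max |h_j| = 1`. -/
def hyperplaneDist {s : ℕ} (ω : Fin s → CInf Fq) : ℝ :=
  ⨅ h : {h : Fin s → FInf Fq // ‖h‖ = 1}, ‖∑ j, h.1 j • ω j‖

/-- The affinoid `Ω^s_n = {ω ∈ Ω^s : |ω|_i ≥ q ^ (-n) |ω|}`, with `|ω| = max |ω_j|`. -/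
def periodDomainLevel (ξ : CInf Fq) (s n : ℕ) : Set (Fin s → CInf Fq) :=
  {ω ∈ periodDomain ξ s | ((Fintype.card Fq : ℝ) ^ n)⁻¹ * ‖ω‖ ≤ hyperplaneDist ω}

/-- The first entry `ω₁` of `ω = (ω₁, ω')`. -/
def firstEntry {r : ℕ} (hr : 2 ≤ r) (ω : Fin r → CInf Fq) : CInf Fq :=
  ω ⟨0, by omega⟩

/-- The vector `ω'` obtained from `ω = (ω₁, ω')` by deleting the first entry. -/
def dropFirst {r : ℕ} (ω : Fin r → CInf Fq) : Fin (r - 1) → CInf Fq :=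
  fun i => ω ⟨i + 1, by omega⟩

/-- The parameter `u = e_{A^{r-1} ω'}(ω₁)⁻¹`. -/
def uParam {r : ℕ} (hr : 2 ≤ r) (ω : Fin r → CInf Fq) : CInf Fq :=
  (latticeExp (lattice (dropFirst ω)) (firstEntry hr ω))⁻¹

end DrinfeldDiscriminant

end

open DrinfeldDiscriminant

/-! Write s = r - 1, L = A^r ω, L' = A^s ω', e' = e_{L'}, m = e'(ω₁) = u⁻¹ and g_a = 1 + f_a(u)
(`unitFactor`); φ' is the Drinfeld module of L'.

The lattice L is the union of the cosets aω₁ - L', so the product for e_L groups into factors 1 -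
e'(x)/e'(aω₁), with e'(x) itself for a = 0 (`hasProd_expo_cons`). The functional equation
φ'_a(e'(x)) = e'(ax) (`eval_phi_expo`) gives e'(aω₁) = φ'_a(m) = Δ'_a m^(q^(s deg a)) g_a
(`expMul_eq_unitFactor`).

Let λ run through the nonzero vectors t⁻¹ ∑ c_j ω_j with constant c_j, and put T = ∏ e_L(λ), P = ∏
e'(λ), G = ∏' g_a. Then Δ T = t. For a ≠ 0 the product of 1 - e'(λ)/e'(aω₁) over λ can be evaluated
through φ'_t; it equals ∏_c g_{ta-c} / g_a^(q^r), with c running through the constants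
(`prod_expFactor_mul_unitFactor_pow`). Every polynomial is uniquely ta - c, and g_c = 1 for nonzero
constants c, so multiplying over all a yields T G^(q^r) = P G. Finally Δ'^q P = -t m^(q-1) by
Wilson's theorem (`prod_partialTorsion`), and cancelling G gives the formula
(`leadingCoeff_phi_eq`).

For convergence, an ultrametric product converges as soon as its factors tend to 1. Here g_a = ∏ (1
- w u) over the zeros w of φ'_a. These form a finite 𝔽_q-space, bounded by some M independent of a
(`norm_torsionMap_le`), and additivity forces |g_a - 1|² ≤ (M|u|)^(q^(s deg a))
(`norm_vanishing_div_sub_one_sq_le`). -/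

noncomputable section

namespace DrinfeldDiscriminant

/-! ### Finite subspaces over a finite field -/

section FiniteSubspace

variable {k K : Type*} [Field k] [Field K] [Algebra k K]

/-- The monic polynomial function whose zeros are the elements of the finite subspace `W`. -/
def vanishing (W : Submodule k K) (x : K) : K := ∏ᶠ w : W, (x - w)

theorem vanishing_eq_prod (W : Submodule k K) [Fintype W] (x : K) :
    vanishing W x = ∏ w : W, (x - w) :=
  finprod_eq_prod_of_fintype _

theorem vanishing_bot (x : K) : vanishing (⊥ : Submodule k K) x = x := by
  rw [vanishing, finprod_unique]
  exact sub_zero x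

theorem vanishing_range {U : Type*} [AddCommGroup U] [Module k U] [Fintype U] (T : U →ₗ[k] K)
    (hT : Function.Injective T) (x : K) :
    vanishing (LinearMap.range T) x = ∏ u, (x - T u) := by
  rw [vanishing, ← finprod_eq_prod_of_fintype]
  exact (finprod_eq_of_bijective (LinearEquiv.ofInjective T hT)
    (LinearEquiv.ofInjective T hT).bijective fun u => by simp).symm

/-- The parametrisation of `W + k y` by `k × W`. -/
def supSpanMap (W : Submodule k K) (y : K) :
    k × W → (W ⊔ Submodule.span k {y} : Submodule k K) :=
  fun p => ⟨p.2 + p.1 • y, Submodule.add_mem_sup p.2.2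
    (Submodule.smul_mem _ _ (Submodule.mem_span_singleton_self y))⟩

theorem supSpanMap_bijective {W : Submodule k K} {y : K} (hy : y ∉ W) :
    Function.Bijective (supSpanMap W y) := by
  constructor
  · rintro ⟨c, w⟩ ⟨c', w'⟩ h
    have h : (w : K) + c • y = w' + c' • y := congrArg Subtype.val h
    have hc : c = c' := by
      by_contra hne
      apply hy
      have h2 : (c - c') • y = (w' : K) - w := by
        rw [sub_smul]; linear_combination h
      have : y = (c - c')⁻¹ • ((w' : K) - w) := by
        rw [← h2, smul_smul, inv_mul_cancel₀ (sub_ne_zero.2 hne), one_smul]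
      rw [this]
      exact W.smul_mem _ (W.sub_mem w'.2 w.2)
    subst hc
    simpa using h
  · rintro ⟨z, hz⟩
    obtain ⟨w, hw, v, hv, rfl⟩ := Submodule.mem_sup.1 hz
    obtain ⟨c, rfl⟩ := Submodule.mem_span_singleton.1 hv
    exact ⟨(c, ⟨w, hw⟩), rfl⟩

variable [Fintype k]

theorem finite_span_of_finite (s : Set K) (hs : s.Finite) : Finite (Submodule.span k s) := by
  have := Module.Finite.span_of_finite k hs
  exact Module.finite_of_finite k

/-- Reduces questions about `vanishing` to adjoining a single vector, where it obeys a recursion. -/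
theorem finite_subspace_induction {P : Submodule k K → Prop} (bot : P ⊥)
    (step : ∀ (W : Submodule k K) (y : K), Finite W → y ∉ W → P W →
      P (W ⊔ Submodule.span k {y})) (W : Submodule k K) [Finite W] : P W := by
  classical
  have key : ∀ s : Finset K, P (Submodule.span k (s : Set K)) := by
    intro s
    induction s using Finset.induction_on with
    | empty => simpa using bot
    | insert y s _ ih =>
      rw [Finset.coe_insert, Set.insert_eq, Submodule.span_union, sup_comm]
      by_cases hy : y ∈ Submodule.span k (s : Set K)
      · rwa [sup_eq_left.2 ((Submodule.span_singleton_le_iff_mem _ _).2 hy)]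
      · exact step _ y (finite_span_of_finite _ s.finite_toSet) hy ih
  have hW : (W : Set K).Finite := Set.toFinite _
  have := key hW.toFinset
  rwa [Set.Finite.coe_toFinset, Submodule.span_eq] at this

theorem vanishing_sup_span {W : Submodule k K} [Finite W] {y : K} (hy : y ∉ W) (x : K) :
    vanishing (W ⊔ Submodule.span k {y}) x = ∏ c : k, vanishing W (x - c • y) := by
  have := Fintype.ofFinite W
  simp_rw [vanishing_eq_prod]
  rw [← Fintype.prod_prod_type', ← finprod_eq_prod_of_fintype, vanishing]
  refine (finprod_eq_of_bijective _ (supSpanMap_bijective hy) fun p => ?_).symm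
  change x - p.1 • y - p.2 = x - (p.2 + p.1 • y)
  ring

theorem card_sup_span {W : Submodule k K} {y : K} (hy : y ∉ W) :
    Nat.card (W ⊔ Submodule.span k {y} : Submodule k K) = Nat.card W * Fintype.card k := by
  rw [← Nat.card_eq_of_bijective _ (supSpanMap_bijective hy), Nat.card_prod,
    Nat.card_eq_fintype_card, mul_comm]

/-- Homogenised form of ∏ (X - c) = X^q - X, evaluated at x / y. -/
theorem prod_sub_smul (x y : K) :
    ∏ c : k, (x - c • y) = x ^ Fintype.card k - y ^ (Fintype.card k - 1) * x := by
  have hq : 0 < Fintype.card k := Fintype.card_pos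
  rcases eq_or_ne y 0 with rfl | hy
  · have : Fintype.card k - 1 ≠ 0 := by
      have := Fintype.one_lt_card (α := k); omega
    simp [zero_pow this]
  · have h1 : ∏ c : k, (X - C c) = (X ^ Fintype.card k - X : k[X]) := by
      have hm := FiniteField.X_pow_card_sub_X_natDegree_eq k (Fintype.one_lt_card (α := k))
      have hr := FiniteField.roots_X_pow_card_sub_X k
      have hmon : (X ^ Fintype.card k - X : k[X]).Monic := by
        apply monic_X_pow_sub
        rw [degree_X]
        exact_mod_cast Fintype.one_lt_card
      have := prod_multiset_X_sub_C_of_monic_of_roots_card_eq hmon (by rw [hr, hm]; rfl)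
      rw [hr] at this
      exact this
    have h2 := congrArg (aeval (x / y)) h1
    simp only [map_prod, map_sub, aeval_X, aeval_C, map_pow] at h2
    have h3 : ∏ c : k, (x - c • y) = y ^ Fintype.card k * ∏ c : k, (x / y - algebraMap k K c) := by
      rw [← Finset.card_univ, ← Finset.prod_const, ← Finset.prod_mul_distrib]
      refine Finset.prod_congr rfl fun c _ => ?_
      rw [Algebra.smul_def]
      field_simp
    rw [h3, h2]
    obtain ⟨m, hm⟩ : ∃ m, Fintype.card k = m + 1 := ⟨_, (Nat.succ_pred_eq_of_pos hq).symm⟩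
    rw [hm, Nat.add_sub_cancel, div_pow]
    field_simp
    ring

/-- Adjoining y replaces f by f^q - f(y)^(q-1) f, and the q-power map is k-linear. -/
theorem vanishing_linear (W : Submodule k K) [Finite W] :
    ∃ f : K →ₗ[k] K, ∀ x, vanishing W x = f x := by
  induction W using finite_subspace_induction with
  | bot => exact ⟨LinearMap.id, vanishing_bot⟩
  | step W y hW hy ih =>
    obtain ⟨f, hf⟩ := ih
    refine ⟨(FiniteField.frobeniusAlgHom k K).toLinearMap ∘ₗ f -
      (f y ^ (Fintype.card k - 1)) • f, fun x => ?_⟩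
    rw [vanishing_sup_span hy]
    simp only [hf, map_sub, map_smul, prod_sub_smul]
    simp

theorem vanishing_sub (W : Submodule k K) [Finite W] (x y : K) :
    vanishing W (x - y) = vanishing W x - vanishing W y := by
  obtain ⟨f, hf⟩ := vanishing_linear W
  simp [hf]

theorem vanishing_smul (W : Submodule k K) [Finite W] (c : k) (x : K) :
    vanishing W (c • x) = c • vanishing W x := by
  obtain ⟨f, hf⟩ := vanishing_linear W
  simp [hf]

theorem vanishing_sup_span' {W : Submodule k K} [Finite W] {y : K} (hy : y ∉ W) (x : K) :
    vanishing (W ⊔ Submodule.span k {y}) x =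
      vanishing W x ^ Fintype.card k - vanishing W y ^ (Fintype.card k - 1) * vanishing W x := by
  rw [vanishing_sup_span hy, ← prod_sub_smul]
  simp only [vanishing_sub, vanishing_smul]

end FiniteSubspace

/-! ### Size of the vanishing polynomial of a finite subspace -/

section FiniteSubspaceNorm

variable {k K : Type*} [Field k] [NormedField K] [Algebra k K] [IsUltrametricDist K]

theorem norm_sub_le_max (x y : K) : ‖x - y‖ ≤ max ‖x‖ ‖y‖ := by
  simpa [sub_eq_add_neg] using IsUltrametricDist.norm_add_le_max x (-y)

theorem norm_sub_le_of_le {x y : K} {M : ℝ} (hx : ‖x‖ ≤ M) (hy : ‖y‖ ≤ M) : ‖x - y‖ ≤ M :=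
  (norm_sub_le_max x y).trans (max_le hx hy)

theorem norm_vanishing_le (W : Submodule k K) [Finite W] {M : ℝ} (hW : ∀ w ∈ W, ‖w‖ ≤ M) {y : K}
    (hy : ‖y‖ ≤ M) : ‖vanishing W y‖ ≤ M ^ Nat.card W := by
  have := Fintype.ofFinite W
  rw [vanishing_eq_prod, norm_prod, Nat.card_eq_fintype_card, ← Finset.card_univ]
  rw [← Finset.prod_const]
  exact Finset.prod_le_prod (fun _ _ => norm_nonneg _) fun w _ => norm_sub_le_of_le hy (hW _ w.2)

variable [Fintype k]

omit [IsUltrametricDist K] in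
theorem norm_algebraMap_finite (c : k) (hc : c ≠ 0) : ‖algebraMap k K c‖ = 1 := by
  have h : algebraMap k K c ^ (Fintype.card k - 1) = 1 := by
    rw [← map_pow, FiniteField.pow_card_sub_one_eq_one c hc, map_one]
  have h2 : ‖algebraMap k K c‖ ^ (Fintype.card k - 1) = 1 := by rw [← norm_pow, h, norm_one]
  have := Fintype.one_lt_card (α := k)
  exact (pow_eq_one_iff_of_nonneg (norm_nonneg _) (by omega)).1 h2

omit [IsUltrametricDist K] in
theorem norm_smul_finite (c : k) (hc : c ≠ 0) (x : K) : ‖c • x‖ = ‖x‖ := by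
  rw [Algebra.smul_def, norm_mul, norm_algebraMap_finite c hc, one_mul]

/-- For `x` large compared to the finite subspace `W`, the product `∏ (1 - w / x)` is close
to `1`. -/
theorem norm_vanishing_div_sub_one_sq_le (W : Submodule k K) [Finite W] {M : ℝ}
    {x : K} (hx : 0 < ‖x‖) (hM : 0 ≤ M) (hMx : M ≤ ‖x‖) (hW : ∀ w ∈ W, ‖w‖ ≤ M) :
    ‖vanishing W x / x ^ Nat.card W - 1‖ ^ 2 ≤ (M / ‖x‖) ^ Nat.card W := by
  have hδ : 0 ≤ M / ‖x‖ := by positivity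
  have hδ1 : M / ‖x‖ ≤ 1 := div_le_one_of_le₀ hMx hx.le
  have hx0 : x ≠ 0 := norm_pos_iff.1 hx
  have hq := Fintype.one_lt_card (α := k)
  induction W using finite_subspace_induction with
  | bot => simpa [vanishing_bot, hx0] using hδ
  | step W y hfin hy ih =>
    have ih := ih fun w hw => hW w (Submodule.mem_sup_left hw)
    have hyM : ‖y‖ ≤ M := hW y (Submodule.mem_sup_right (Submodule.mem_span_singleton_self y))
    have hWM := norm_vanishing_le W (fun w hw => hW w (Submodule.mem_sup_left hw)) hyM
    rw [card_sup_span hy, vanishing_sup_span' hy]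
    set N := Nat.card W
    set q := Fintype.card k
    set g := vanishing W x / x ^ N with hg
    set b := vanishing W y / x ^ N with hb
    have hxN : x ^ N ≠ 0 := pow_ne_zero _ hx0
    have e1 : vanishing W x = g * x ^ N := by rw [hg, div_mul_cancel₀ _ hxN]
    have e2 : vanishing W y = b * x ^ N := by rw [hb, div_mul_cancel₀ _ hxN]
    have hbn : ‖b‖ ≤ (M / ‖x‖) ^ N := by
      rw [hb, norm_div, norm_pow, div_pow]
      gcongr
    have hg1 : ‖g - 1‖ ≤ 1 := by
      have : ‖g - 1‖ ^ 2 ≤ 1 := ih.trans (pow_le_one₀ hδ hδ1)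
      nlinarith [norm_nonneg (g - 1)]
    have hgn : ‖g‖ ≤ 1 := by
      have := IsUltrametricDist.norm_add_le_max (g - 1) 1
      rw [sub_add_cancel, norm_one, max_eq_right hg1] at this
      exact this
    -- The recursion for `vanishing`, divided by x^(Nq); since q-th powers are additive, the
    -- deviation from 1 obeys a recursion of its own.
    have e3 : (vanishing W x ^ q - vanishing W y ^ (q - 1) * vanishing W x) / x ^ (N * q) - 1 =
        (g - 1) ^ q - b ^ (q - 1) * g := by
      have h1 : (g - 1) ^ q = g ^ q - 1 := by
        have := map_sub (FiniteField.frobeniusAlgHom k K) g 1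
        simpa using this
      obtain ⟨m, hm⟩ : ∃ m, q = m + 1 := ⟨q - 1, by omega⟩
      rw [h1, e1, e2, pow_mul, hm, Nat.add_sub_cancel]
      field_simp
      ring
    rw [e3]
    have h1 : ‖(g - 1) ^ q‖ ^ 2 ≤ (M / ‖x‖) ^ (N * q) := by
      rw [norm_pow, ← pow_mul, mul_comm q 2, pow_mul, pow_mul]
      gcongr
    -- This term only has exponent N(q-1). Squaring recovers the required Nq because 2(q-1) ≥ q;
    -- this is why the estimate is stated for the square.
    have h2 : ‖b ^ (q - 1) * g‖ ^ 2 ≤ (M / ‖x‖) ^ (N * q) := by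
      calc ‖b ^ (q - 1) * g‖ ^ 2 ≤ (((M / ‖x‖) ^ N) ^ (q - 1) * 1) ^ 2 := by
            rw [norm_mul, norm_pow]
            gcongr
        _ = (M / ‖x‖) ^ (N * ((q - 1) * 2)) := by rw [mul_one, ← pow_mul, ← pow_mul, ← mul_assoc]
        _ ≤ (M / ‖x‖) ^ (N * q) := by
            apply pow_le_pow_of_le_one hδ hδ1
            apply Nat.mul_le_mul_left
            omega
    have h3 := norm_sub_le_max ((g - 1) ^ q) (b ^ (q - 1) * g)
    rcases max_choice ‖(g - 1) ^ q‖ ‖b ^ (q - 1) * g‖ with h | h <;> rw [h] at h3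
    · exact (pow_le_pow_left₀ (norm_nonneg _) h3 2).trans h1
    · exact (pow_le_pow_left₀ (norm_nonneg _) h3 2).trans h2

end FiniteSubspaceNorm

/-! ### Infinite products over an ultrametric field -/

section UltrametricProduct

open Filter

variable {ι K : Type*} [NormedField K] [IsUltrametricDist K]

theorem norm_le_one_of_norm_sub_one_le {x : K} (h : ‖x - 1‖ ≤ 1) : ‖x‖ ≤ 1 := by
  have := IsUltrametricDist.norm_add_le_max (x - 1) 1
  rwa [sub_add_cancel, norm_one, max_eq_right h] at this

theorem norm_eq_one_of_norm_sub_one_lt {x : K} (h : ‖x - 1‖ < 1) : ‖x‖ = 1 := by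
  have := IsUltrametricDist.norm_add_eq_max_of_norm_ne_norm (x := x - 1) (y := 1)
    (by rw [norm_one]; exact h.ne)
  rwa [sub_add_cancel, norm_one, max_eq_right h.le] at this

theorem norm_mul_sub_one_le {x y : K} {ε : ℝ} (hε : ε ≤ 1) (hx : ‖x - 1‖ ≤ ε)
    (hy : ‖y - 1‖ ≤ ε) : ‖x * y - 1‖ ≤ ε := by
  have h : x * y - 1 = (x - 1) * y + (y - 1) := by ring
  rw [h]
  refine (IsUltrametricDist.norm_add_le_max _ _).trans (max_le ?_ hy)
  rw [norm_mul]
  have := norm_le_one_of_norm_sub_one_le (hy.trans hε)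
  nlinarith [norm_nonneg (x - 1)]

theorem norm_prod_sub_one_le {f : ι → K} {s : Finset ι} {ε : ℝ} (hε0 : 0 ≤ ε) (hε : ε ≤ 1)
    (h : ∀ i ∈ s, ‖f i - 1‖ ≤ ε) : ‖∏ i ∈ s, f i - 1‖ ≤ ε := by
  classical
  induction s using Finset.induction_on with
  | empty => simpa using hε0
  | insert i s hi ih =>
    rw [Finset.prod_insert hi]
    exact norm_mul_sub_one_le hε (h _ (Finset.mem_insert_self _ _))
      (ih fun j hj => h _ (Finset.mem_insert_of_mem hj))

theorem norm_pow_sub_one_le {x : K} {ε : ℝ} (hε0 : 0 ≤ ε) (hε : ε ≤ 1) (h : ‖x - 1‖ ≤ ε) (n : ℕ) :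
    ‖x ^ n - 1‖ ≤ ε := by
  have := norm_prod_sub_one_le (f := fun _ : ℕ => x) (s := Finset.range n) hε0 hε fun _ _ => h
  simpa using this

/-- The additional factors multiply to an element within ε of 1: errors do not accumulate in an
ultrametric field. -/
theorem norm_prod_sub_prod_le {f : ι → K} {s t : Finset ι} (hst : s ⊆ t) {ε : ℝ} (hε0 : 0 ≤ ε)
    (hε : ε ≤ 1) (h : ∀ i ∉ s, ‖f i - 1‖ ≤ ε) :
    ‖∏ i ∈ t, f i - ∏ i ∈ s, f i‖ ≤ ‖∏ i ∈ s, f i‖ * ε := by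
  classical
  rw [← Finset.prod_sdiff hst]
  have : (∏ i ∈ t \ s, f i) * ∏ i ∈ s, f i - ∏ i ∈ s, f i =
    (∏ i ∈ s, f i) * (∏ i ∈ t \ s, f i - 1) := by ring
  rw [this, norm_mul]
  gcongr
  exact norm_prod_sub_one_le hε0 hε fun i hi => h i (Finset.mem_sdiff.1 hi).2

omit [IsUltrametricDist K] in
theorem exists_finset_of_tendsto_one {f : ι → K} (hf : Tendsto f cofinite (𝓝 1)) {ε : ℝ}
    (hε : 0 < ε) : ∃ s : Finset ι, ∀ i ∉ s, ‖f i - 1‖ < ε := by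
  have h : ∀ᶠ i in cofinite, ‖f i - 1‖ < ε := by
    have := hf.eventually (Metric.ball_mem_nhds 1 hε)
    simpa [dist_eq_norm] using this
  exact ⟨(Filter.eventually_cofinite.1 h).toFinset, fun i hi => by simpa using hi⟩

omit [IsUltrametricDist K] in
theorem tendsto_prod_of_hasProd {f : ι → K} {a : K} (h : HasProd f a) :
    Tendsto (fun s : Finset ι => ∏ i ∈ s, f i) atTop (𝓝 a) := by
  simpa [HasProd] using h

omit [IsUltrametricDist K] in
theorem hasProd_of_tendsto_prod {f : ι → K} {a : K}
    (h : Tendsto (fun s : Finset ι => ∏ i ∈ s, f i) atTop (𝓝 a)) : HasProd f a := by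
  simpa [HasProd] using h

/-- Outside `s₀` all factors lie in the unit ball, so later partial products stay bounded by `B`;
outside `s₁` the remaining factors barely change them. -/
theorem multipliable_of_tendsto_one [CompleteSpace K] {f : ι → K}
    (hf : Tendsto f cofinite (𝓝 1)) : Multipliable f := by
  classical
  obtain ⟨s₀, hs₀⟩ := exists_finset_of_tendsto_one hf one_pos
  have hc : CauchySeq (fun s : Finset ι => ∏ i ∈ s, f i) := by
    rw [Metric.cauchySeq_iff']
    intro ε hε
    set B := ‖∏ i ∈ s₀, f i‖ with hB
    have hB0 : 0 ≤ B := norm_nonneg _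
    -- `B + 1` instead of `B`, since `B` is zero when a factor over `s₀` vanishes.
    set δ := min 1 (ε / (2 * (B + 1))) with hδ
    have hδ0 : 0 < δ := by positivity
    obtain ⟨s₁, hs₁⟩ := exists_finset_of_tendsto_one hf hδ0
    refine ⟨s₀ ∪ s₁, fun t ht => ?_⟩
    rw [dist_eq_norm]
    refine (norm_prod_sub_prod_le ht hδ0.le (min_le_left _ _) fun i hi =>
      (hs₁ i fun h => hi (Finset.mem_union_right _ h)).le).trans_lt ?_
    have h1 : ‖∏ i ∈ s₀ ∪ s₁, f i‖ ≤ B := by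
      rw [← Finset.prod_sdiff (Finset.subset_union_left : s₀ ⊆ s₀ ∪ s₁), norm_mul]
      refine mul_le_of_le_one_left hB0 ?_
      apply norm_le_one_of_norm_sub_one_le
      exact norm_prod_sub_one_le zero_le_one le_rfl fun i hi => (hs₀ i (Finset.mem_sdiff.1 hi).2).le
    have h2 : δ ≤ ε / (2 * (B + 1)) := min_le_right _ _
    calc _ ≤ B * (ε / (2 * (B + 1))) := by gcongr
      _ = (B / (B + 1)) * (ε / 2) := by field_simp
      _ ≤ 1 * (ε / 2) := by
        gcongr
        exact div_le_one_of_le₀ (by linarith) (by positivity)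
      _ < ε := by linarith
  obtain ⟨a, ha⟩ := cauchySeq_tendsto_of_complete hc
  exact ⟨a, hasProd_of_tendsto_prod ha⟩

/-- Factors at distance less than 1 from 1 have norm 1, so the norm of the partial products is
eventually constant. -/
theorem ne_zero_of_hasProd {f : ι → K} (hf : Tendsto f cofinite (𝓝 1)) (h0 : ∀ i, f i ≠ 0)
    {a : K} (ha : HasProd f a) : a ≠ 0 := by
  classical
  obtain ⟨s₀, hs₀⟩ := exists_finset_of_tendsto_one hf one_pos
  have h1 := (tendsto_prod_of_hasProd ha).norm
  have h2 : ∀ᶠ t : Finset ι in atTop, ‖∏ i ∈ t, f i‖ = ‖∏ i ∈ s₀, f i‖ := by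
    filter_upwards [eventually_ge_atTop s₀] with t ht
    rw [← Finset.prod_sdiff ht, norm_mul, norm_prod, Finset.prod_eq_one, one_mul]
    exact fun i hi => norm_eq_one_of_norm_sub_one_lt (hs₀ i (Finset.mem_sdiff.1 hi).2)
  have h3 := tendsto_nhds_unique (h1.congr' h2) tendsto_const_nhds
  rw [← norm_ne_zero_iff, h3, norm_ne_zero_iff]
  exact Finset.prod_ne_zero_iff.2 fun i _ => h0 i

/-- By `h1` all partial products have norm at most 1 on the whole set, so the tail estimate does not
depend on the point. -/
theorem multipliableUniformlyOn_of_norm_sub_one_le [CompleteSpace K] {β : Type*} {f : ι → β → K}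
    {s : Set β} (h1 : ∀ i, ∀ x ∈ s, ‖f i x - 1‖ ≤ 1)
    (h : ∀ ε > 0, ∀ᶠ i in cofinite, ∀ x ∈ s, ‖f i x - 1‖ ≤ ε) : MultipliableUniformlyOn f s := by
  classical
  have hm : ∀ x ∈ s, Multipliable fun i => f i x := by
    intro x hx
    apply multipliable_of_tendsto_one
    rw [Metric.tendsto_nhds]
    intro ε hε
    filter_upwards [h (ε / 2) (by positivity)] with i hi
    rw [dist_eq_norm]
    linarith [hi x hx]
  have : HasProdUniformlyOn f (fun x => ∏' i, f i x) s := by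
    rw [hasProdUniformlyOn_iff_tendstoUniformlyOn, Metric.tendstoUniformlyOn_iff]
    intro ε hε
    set δ := min 1 (ε / 2) with hδ
    have hδ0 : 0 < δ := by positivity
    have hfin := Filter.eventually_cofinite.1 (h δ hδ0)
    filter_upwards [eventually_ge_atTop hfin.toFinset] with t ht x hx
    have hlim := tendsto_prod_of_hasProd (hm x hx).hasProd
    rw [dist_eq_norm]
    refine lt_of_le_of_lt (b := δ) ?_ ((min_le_right _ _).trans_lt (by linarith))
    refine le_of_tendsto (hlim.sub_const (∏ i ∈ t, f i x)).norm ?_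
    filter_upwards [eventually_ge_atTop t] with t' ht'
    refine (norm_prod_sub_prod_le ht' hδ0.le (min_le_left _ _) fun i hi => ?_).trans ?_
    · by_contra hcon
      exact hi (ht (by
        rw [Set.Finite.mem_toFinset]
        exact fun hall => hcon (hall x hx)))
    · refine mul_le_of_le_one_left hδ0.le ?_
      apply norm_le_one_of_norm_sub_one_le
      exact norm_prod_sub_one_le zero_le_one le_rfl fun i _ => h1 i x hx
  exact this.multipliableUniformlyOn

end UltrametricProduct

/-! ### Exponential functions of discrete subspaces -/

section Exponential

open Filter

/-- The factor of the exponential product that belongs to `l`; the factor of `0` is `x` itself. -/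
def expFactor {K : Type*} [Field K] (x l : K) : K :=
  open Classical in if l = 0 then x else 1 - x / l

section

variable {K : Type*} [Field K]

@[simp]
theorem expFactor_zero (x : K) : expFactor x 0 = x := if_pos rfl

theorem expFactor_of_ne {x l : K} (h : l ≠ 0) : expFactor x l = 1 - x / l := if_neg h

theorem expFactor_self (x : K) : expFactor x x = 0 := by
  rcases eq_or_ne x 0 with rfl | h
  · simp
  · rw [expFactor_of_ne h, div_self h, sub_self]

theorem expFactor_ne_zero {x l : K} (h : x ≠ l) : expFactor x l ≠ 0 := by
  rcases eq_or_ne l 0 with rfl | hl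
  · simpa using h
  · rw [expFactor_of_ne hl]
    intro h0
    apply h
    field_simp at h0
    linear_combination -h0

end

variable {k K : Type*} [Field k] [NormedField K] [Algebra k K]

/-- The exponential function of a subspace. -/
def expo (L : Submodule k K) (x : K) : K :=
  x * ∏' l : {l : L // l ≠ 0}, (1 - x / (l : K))

/-- A subspace is discrete if it has finite intersection with every ball. -/
def IsDiscreteSubspace (L : Submodule k K) : Prop :=
  ∀ B : ℝ, {l : L | ‖(l : K)‖ ≤ B}.Finite

variable {L : Submodule k K}

theorem IsDiscreteSubspace.tendsto_expFactor (hL : IsDiscreteSubspace L) (x : K) :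
    Tendsto (fun l : L => expFactor x (l : K)) cofinite (𝓝 1) := by
  rw [Metric.tendsto_nhds]
  intro ε hε
  have h := hL (‖x‖ / ε)
  rw [Filter.eventually_cofinite]
  refine h.subset fun l hl => ?_
  rw [Set.mem_ofPred_eq] at hl ⊢
  by_contra hcon
  rw [not_le] at hcon
  apply hl
  have hl0 : 0 < ‖(l : K)‖ := lt_of_le_of_lt (by positivity) hcon
  rw [expFactor_of_ne (norm_pos_iff.1 hl0), dist_eq_norm]
  have : (1 : K) - x / l - 1 = -(x / l) := by ring
  rw [this, norm_neg, norm_div, div_lt_iff₀ hl0]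
  rw [div_lt_iff₀ hε] at hcon
  linarith

variable [IsUltrametricDist K] [CompleteSpace K]

theorem IsDiscreteSubspace.hasProd_expo (hL : IsDiscreteSubspace L) (x : K) :
    HasProd (fun l : L => expFactor x (l : K)) (expo L x) := by
  classical
  have hm : Multipliable fun l : {l : L // l ≠ 0} => (1 - x / ((l : L) : K)) := by
    have h1 := (hL.tendsto_expFactor x).comp
      (Subtype.val_injective (p := fun l : L => l ≠ 0)).tendsto_cofinite
    refine (multipliable_of_tendsto_one h1).congr fun l => ?_
    exact expFactor_of_ne fun h => l.2 (Subtype.ext h)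
  have h2 : HasProd (fun l : L => if l = 0 then 1 else 1 - x / (l : K))
      (∏' l : {l : L // l ≠ 0}, (1 - x / (l : K))) := by
    rw [← hasProd_subtype_iff_of_mulSupport_subset (s := {l : L | l ≠ 0})]
    · refine hm.hasProd.congr_fun ?_ |> id
      intro l
      exact (if_neg l.2)
    · intro l hl h0
      exact hl (if_pos h0)
  have h3 := (hasProd_ite_eq (0 : L) x).mul h2
  refine h3.congr_fun fun l => ?_
  by_cases h : l = 0
  · simp [h]
  · rw [if_neg h, if_neg h, one_mul]
    exact expFactor_of_ne fun h' => h (Subtype.ext h')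

theorem IsDiscreteSubspace.expo_eq_zero_iff (hL : IsDiscreteSubspace L) {x : K} :
    expo L x = 0 ↔ x ∈ L := by
  constructor
  · intro h
    by_contra hx
    refine ne_zero_of_hasProd (hL.tendsto_expFactor x) (fun l => ?_) (hL.hasProd_expo x) h
    apply expFactor_ne_zero
    rintro rfl
    exact hx l.2
  · intro hx
    refine tendsto_nhds_unique (tendsto_prod_of_hasProd (hL.hasProd_expo x)) ?_
    refine tendsto_const_nhds.congr' ?_
    filter_upwards [eventually_ge_atTop {(⟨x, hx⟩ : L)}] with t ht
    exact (Finset.prod_eq_zero (ht (Finset.mem_singleton_self _)) (expFactor_self x)).symm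

variable [Fintype k]

/-- The elements of norm at most `B` of a subspace. -/
def normLE (L : Submodule k K) (B : ℝ) (hB : 0 ≤ B) : Submodule k K where
  carrier := {l | l ∈ L ∧ ‖l‖ ≤ B}
  zero_mem' := ⟨L.zero_mem, by simpa using hB⟩
  add_mem' := fun h h' => ⟨L.add_mem h.1 h'.1,
    (IsUltrametricDist.norm_add_le_max _ _).trans (max_le h.2 h'.2)⟩
  smul_mem' := fun c x h => ⟨L.smul_mem c h.1, by
    rcases eq_or_ne c 0 with rfl | hc
    · simpa using hB
    · rw [norm_smul_finite c hc]; exact h.2⟩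

-- Up to a scalar the truncated product is `vanishing` of `normLE L B hB`, which is a subspace
-- because the norm is ultrametric and nonzero constants have norm 1.
omit [CompleteSpace K] in
theorem IsDiscreteSubspace.exists_linearMap (hL : IsDiscreteSubspace L) {B : ℝ} (hB : 0 ≤ B) :
    ∃ f : K →ₗ[k] K, ∀ x, ∏ l ∈ (hL B).toFinset, expFactor x (l : K) = f x := by
  classical
  let e : normLE L B hB ≃ (hL B).toFinset :=
    { toFun := fun w => ⟨⟨w, w.2.1⟩, by rw [Set.Finite.mem_toFinset]; exact w.2.2⟩
      invFun := fun l => ⟨l.1, l.1.2, by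
        have := l.2
        rwa [Set.Finite.mem_toFinset] at this⟩
      left_inv := fun w => rfl
      right_inv := fun l => rfl }
  have : Finite (normLE L B hB) := Finite.of_equiv _ e.symm
  have := Fintype.ofFinite (normLE L B hB)
  obtain ⟨f, hf⟩ := vanishing_linear (normLE L B hB)
  -- The zero vector gets coefficient 1, since `expFactor x 0` already equals its factor x - 0.
  set c : K := ∏ w : normLE L B hB, if (w : K) = 0 then 1 else -(w : K)⁻¹ with hc
  refine ⟨c • f, fun x => ?_⟩
  rw [LinearMap.smul_apply, ← hf, vanishing_eq_prod, hc, smul_eq_mul, ← Finset.prod_mul_distrib,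
    ← Finset.prod_coe_sort, ← e.prod_comp]
  refine Finset.prod_congr rfl fun w _ => ?_
  change expFactor x (w : K) = _
  split_ifs with h
  · simp [h]
  · rw [expFactor_of_ne h]
    field_simp
    ring

/-- Linearity passes to the pointwise limit of the truncations to balls of radius n. -/
theorem IsDiscreteSubspace.exists_expo_eq (hL : IsDiscreteSubspace L) :
    ∃ f : K →ₗ[k] K, ∀ x, expo L x = f x := by
  have htop : Tendsto (fun n : ℕ => (hL n).toFinset) atTop atTop := by
    refine Monotone.tendsto_atTop_finset (fun m n hmn l hl => ?_) fun l => ?_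
    · rw [Set.Finite.mem_toFinset] at hl ⊢
      exact le_trans (b := (m : ℝ)) hl (by exact_mod_cast hmn)
    · obtain ⟨n, hn⟩ := exists_nat_ge ‖(l : K)‖
      exact ⟨n, by rwa [Set.Finite.mem_toFinset]⟩
  have hlim : ∀ x, Tendsto (fun n : ℕ => ∏ l ∈ (hL n).toFinset, expFactor x (l : K)) atTop
      (𝓝 (expo L x)) := fun x => (tendsto_prod_of_hasProd (hL.hasProd_expo x)).comp htop
  choose f hf using fun n : ℕ => hL.exists_linearMap (Nat.cast_nonneg n)
  simp only [hf] at hlim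
  refine ⟨⟨⟨expo L, fun x y => ?_⟩, fun c x => ?_⟩, fun x => rfl⟩
  · refine tendsto_nhds_unique (hlim (x + y)) ?_
    simpa only [map_add] using (hlim x).add (hlim y)
  · refine tendsto_nhds_unique (hlim (c • x)) ?_
    simp only [map_smul]
    simp only [Algebra.smul_def, RingHom.id_apply]
    exact (hlim x).const_mul _

theorem IsDiscreteSubspace.expo_sub (hL : IsDiscreteSubspace L) (x y : K) :
    expo L (x - y) = expo L x - expo L y := by
  obtain ⟨f, hf⟩ := hL.exists_expo_eq
  simp [hf]

/-- Multiplying by the factor of e_L(z) at l turns 1 - x/(z - l) into the factor of e_L(z - x) at l;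
then e_L(z - x) = e_L(z) - e_L(x). -/
theorem IsDiscreteSubspace.hasProd_coset (hL : IsDiscreteSubspace L) (x : K) {z : K} (hz : z ∉ L) :
    HasProd (fun l : L => 1 - x / (z - l)) (1 - expo L x / expo L z) := by
  have hzl : ∀ l : L, z - l ≠ 0 := fun l h => hz (by rw [sub_eq_zero.1 h]; exact l.2)
  have hez : expo L z ≠ 0 := fun h => hz (hL.expo_eq_zero_iff.1 h)
  have hmul : ∀ l : L, (1 - x / (z - l)) * expFactor z (l : K) = expFactor (z - x) (l : K) := by
    intro l
    have := hzl l
    rcases eq_or_ne (l : K) 0 with h0 | h0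
    · rw [h0] at this ⊢
      simp only [expFactor_zero, sub_zero] at this ⊢
      field_simp
    · rw [expFactor_of_ne h0, expFactor_of_ne h0]
      field_simp
      ring
  have hne : ∀ l : L, expFactor z (l : K) ≠ 0 := fun l =>
    expFactor_ne_zero (by rintro rfl; exact hz l.2)
  have htend : Tendsto (fun l : L => 1 - x / (z - l)) cofinite (𝓝 1) := by
    have := (hL.tendsto_expFactor (z - x)).div (hL.tendsto_expFactor z) one_ne_zero
    rw [div_one] at this
    refine this.congr fun l => ?_
    rw [Pi.div_apply, ← hmul l, mul_div_cancel_right₀ _ (hne l)]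
  have h1 := (multipliable_of_tendsto_one htend).hasProd
  have h2 := (h1.mul (hL.hasProd_expo z)).unique
    ((hL.hasProd_expo (z - x)).congr_fun hmul)
  rw [hL.expo_sub] at h2
  have h3 : 1 - expo L x / expo L z = ∏' l : L, (1 - x / (z - l)) := by
    field_simp
    linear_combination -h2
  rw [h3]
  exact h1

/-- The exponential function of a larger discrete subspace `L'`, as a product over representatives
of the cosets of `L`. -/
theorem IsDiscreteSubspace.hasProd_expo_of_equiv {L' : Submodule k K} (hL : IsDiscreteSubspace L)
    (hL' : IsDiscreteSubspace L') {I : Type*} (ρ : I → K) {i₀ : I} (h₀ : ρ i₀ = 0)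
    (e : I × L ≃ L') (he : ∀ p, (e p : K) = ρ p.1 - p.2) (x : K) :
    HasProd (fun i => expFactor (expo L x) (expo L (ρ i))) (expo L' x) := by
  refine HasProd.prod_fiberwise ((Equiv.hasProd_iff e).2 (hL'.hasProd_expo x)) fun i => ?_
  simp only [Function.comp_apply, he]
  -- The fibre over i is the coset ρ i - L. For `i₀` this is L itself, up to the sign of l; the
  -- other cosets avoid zero and are covered by `hasProd_coset`.
  rcases eq_or_ne i i₀ with rfl | hi
  · rw [h₀, hL.expo_eq_zero_iff.2 L.zero_mem, expFactor_zero]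
    refine ((Equiv.hasProd_iff (Equiv.neg L)).2 (hL.hasProd_expo x)).congr_fun fun l => ?_
    simp
  · have hz : ρ i ∉ L := by
      intro hmem
      apply hi
      have : (i, (⟨ρ i, hmem⟩ : L)) = (i₀, 0) := by
        apply e.injective
        apply Subtype.ext
        simp [he, h₀]
      exact congrArg Prod.fst this
    rw [expFactor_of_ne fun h => hz (hL.expo_eq_zero_iff.1 h)]
    refine (hL.hasProd_coset x hz).congr_fun fun l => ?_
    rw [expFactor_of_ne]
    intro h
    exact hz (by rw [sub_eq_zero.1 h]; exact l.2)

-- Only the elements of `S` can give factors of norm above 1, each at most R/η ≤ B; the zero vector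
-- contributes at most R.
omit [Fintype k] in
theorem IsDiscreteSubspace.norm_expo_le (hL : IsDiscreteSubspace L) {R B η : ℝ} (hη : 0 < η)
    (hB1 : 1 ≤ B) (hB : R / η ≤ B) (S : Finset L) (hS : ∀ l : L, l ∉ S → R ≤ ‖(l : K)‖)
    (hLη : ∀ l : L, l ≠ 0 → η ≤ ‖(l : K)‖) {x : K} (hx : ‖x‖ ≤ R) :
    ‖expo L x‖ ≤ R * B ^ S.card := by
  classical
  have hR : 0 ≤ R := (norm_nonneg x).trans hx
  have hb : ∀ l : L,
      ‖expFactor x (l : K)‖ ≤ (if l = 0 then R else 1) * (if l ∈ S then B else 1) := by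
    intro l
    by_cases h0 : l = 0
    · rw [if_pos h0, h0, Submodule.coe_zero, expFactor_zero]
      split_ifs
      · nlinarith
      · linarith
    · have hl : (l : K) ≠ 0 := fun h => h0 (Subtype.ext h)
      rw [if_neg h0, one_mul, expFactor_of_ne hl]
      refine (norm_sub_le_max _ _).trans (max_le ?_ ?_)
      · rw [norm_one]; split_ifs <;> linarith
      · rw [norm_div]
        split_ifs with h
        · refine le_trans ?_ hB
          gcongr
          exact hLη l h0
        · exact div_le_one_of_le₀ (hx.trans (hS l h)) (norm_nonneg _)
  refine le_of_tendsto (tendsto_prod_of_hasProd (hL.hasProd_expo x)).norm ?_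
  filter_upwards [eventually_ge_atTop {(0 : L)}] with t ht
  have h0 : (0 : L) ∈ t := ht (Finset.mem_singleton_self _)
  rw [norm_prod]
  refine (Finset.prod_le_prod (fun _ _ => norm_nonneg _) fun l _ => hb l).trans ?_
  rw [Finset.prod_mul_distrib, Finset.prod_ite_eq' t 0 fun _ => R, if_pos h0, Finset.prod_ite_mem,
    Finset.prod_const]
  gcongr
  exact Finset.inter_subset_right

end Exponential

/-! ### The polynomial attached to a finite subspace -/

section SubspacePoly

variable {k K U : Type*} [Field k] [Field K] [Algebra k K] [AddCommGroup U] [Module k U] [Fintype U]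
  [DecidableEq U]

/-- The polynomial `α X ∏' (1 - X / T u)`, with `u` running through the nonzero elements of `U`. -/
def subspacePoly (α : K) (T : U →ₗ[k] K) : K[X] :=
  C α * X * ∏ u : {u : U // u ≠ 0}, (1 - C (T u)⁻¹ * X)

theorem prod_eq_mul_prod_ne_zero {M : Type*} [CommMonoid M] (f : U → M) :
    ∏ u, f u = f 0 * ∏ u : {u : U // u ≠ 0}, f u := by
  rw [← Finset.mul_prod_erase Finset.univ f (Finset.mem_univ 0)]
  congr 1
  exact Finset.prod_subtype _ (by simp) f

/-- Removes the signs of the roots without a case distinction on the parity of q. -/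
theorem prod_ne_zero_neg (T : U →ₗ[k] K) :
    ∏ u : {u : U // u ≠ 0}, (-T u) = ∏ u : {u : U // u ≠ 0}, T u := by
  refine Fintype.prod_equiv ((Equiv.neg U).subtypeEquiv (by simp)) _ _ fun u => ?_
  simp

variable {α : K} {T : U →ₗ[k] K}

theorem subspacePoly_eq (hT : Function.Injective T) :
    subspacePoly α T = C (α * ∏ u : {u : U // u ≠ 0}, (-(T u)⁻¹)) * ∏ u, (X - C (T u)) := by
  have key : ∏ u : {u : U // u ≠ 0}, (1 - C (T u)⁻¹ * X) =
      C (∏ u : {u : U // u ≠ 0}, (-(T u)⁻¹)) * ∏ u : {u : U // u ≠ 0}, (X - C (T u)) := by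
    rw [map_prod, ← Finset.prod_mul_distrib]
    refine Finset.prod_congr rfl fun u _ => ?_
    have hu : T u ≠ 0 := fun h => u.2 (hT (by rw [h, map_zero]))
    rw [mul_sub, ← C_mul, neg_mul, inv_mul_cancel₀ hu]
    simp
    ring
  rw [prod_eq_mul_prod_ne_zero fun u => X - C (T u), map_zero, C_0, sub_zero, subspacePoly, key,
    C_mul]
  ring

theorem leadingCoeff_subspacePoly (hT : Function.Injective T) :
    (subspacePoly α T).leadingCoeff = α * ∏ u : {u : U // u ≠ 0}, (-(T u)⁻¹) := by
  rw [subspacePoly_eq hT, leadingCoeff_mul, leadingCoeff_C,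
    (monic_prod_X_sub_C _ _).leadingCoeff, mul_one]

/-- Turns discriminants into products of torsion values, for the lattice of rank s + 1 and for the
one of rank s. -/
theorem leadingCoeff_subspacePoly_mul_prod (hT : Function.Injective T) :
    (subspacePoly α T).leadingCoeff * ∏ u : {u : U // u ≠ 0}, T u = α := by
  rw [leadingCoeff_subspacePoly hT, ← prod_ne_zero_neg, mul_assoc, ← Finset.prod_mul_distrib,
    Finset.prod_eq_one, mul_one]
  intro u _
  have hu : T u ≠ 0 := fun h => u.2 (hT (by rw [h, map_zero]))
  rw [neg_mul_neg, inv_mul_cancel₀ hu]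

theorem leadingCoeff_subspacePoly_ne_zero (hT : Function.Injective T) (hα : α ≠ 0) :
    (subspacePoly α T).leadingCoeff ≠ 0 := by
  intro h
  apply hα
  rw [← leadingCoeff_subspacePoly_mul_prod hT (α := α), h, zero_mul]

theorem natDegree_subspacePoly (hT : Function.Injective T) (hα : α ≠ 0) :
    (subspacePoly α T).natDegree = Fintype.card U := by
  have h := leadingCoeff_subspacePoly_ne_zero hT hα
  rw [leadingCoeff_subspacePoly hT] at h
  rw [subspacePoly_eq hT, natDegree_C_mul h, natDegree_prod_of_monic _ _ fun u _ => monic_X_sub_C _]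
  simp

theorem eval_subspacePoly (hT : Function.Injective T) (y : K) :
    (subspacePoly α T).eval y =
      (subspacePoly α T).leadingCoeff * vanishing (LinearMap.range T) y := by
  rw [vanishing_range T hT, leadingCoeff_subspacePoly hT]
  nth_rw 1 [subspacePoly_eq hT]
  simp [eval_prod]

/-- The polynomial `X ^ N P(X⁻¹) / δ` for a polynomial `P` of degree `N` with leading
coefficient `δ`. -/
theorem eval_reflect_subspacePoly (hT : Function.Injective T) (hα : α ≠ 0) {u : K} (hu : u ≠ 0) :
    (C (subspacePoly α T).leadingCoeff⁻¹ * (subspacePoly α T).reflect (Fintype.card U)).eval u =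
      u ^ Fintype.card U * vanishing (LinearMap.range T) u⁻¹ := by
  have : Invertible u⁻¹ := invertibleOfNonzero (inv_ne_zero hu)
  have h := eval₂_reflect_mul_pow (RingHom.id K) u⁻¹ (Fintype.card U) (subspacePoly α T)
    (natDegree_subspacePoly hT hα).le
  rw [invOf_eq_inv, inv_inv] at h
  change eval u _ * _ = eval u⁻¹ _ at h
  rw [eval_subspacePoly hT, inv_pow, ← div_eq_mul_inv, div_eq_iff (pow_ne_zero _ hu)] at h
  rw [eval_mul, eval_C, h]
  have := leadingCoeff_subspacePoly_ne_zero hT hα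
  field_simp

theorem eval_zero_reflect_subspacePoly (hT : Function.Injective T) (hα : α ≠ 0) :
    (C (subspacePoly α T).leadingCoeff⁻¹ *
      (subspacePoly α T).reflect (Fintype.card U)).eval 0 = 1 := by
  rw [eval_mul, eval_C, ← coeff_zero_eq_eval_zero, coeff_reflect, revAt_le (Nat.zero_le _),
    Nat.sub_zero, ← natDegree_subspacePoly hT hα, coeff_natDegree,
    inv_mul_cancel₀ (leadingCoeff_subspacePoly_ne_zero hT hα)]

end SubspacePoly

theorem norm_eval_reflect_subspacePoly_sub_one_sq_le {k K U : Type*} [Field k] [Fintype k]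
    [NormedField K] [IsUltrametricDist K] [Algebra k K] [AddCommGroup U] [Module k U] [Fintype U]
    [DecidableEq U] {α : K} {T : U →ₗ[k] K} (hT : Function.Injective T) (hα : α ≠ 0) {M : ℝ}
    (hM : 0 ≤ M) (hTM : ∀ v, ‖T v‖ ≤ M) {u : K} (hu : M * ‖u‖ ≤ 1) :
    ‖(C (subspacePoly α T).leadingCoeff⁻¹ *
      (subspacePoly α T).reflect (Fintype.card U)).eval u - 1‖ ^ 2 ≤
        (M * ‖u‖) ^ Fintype.card U := by
  -- The value 0 lies in the ball but has no inverse; there the reflected polynomial is evaluated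
  -- through its constant coefficient.
  rcases eq_or_ne u 0 with rfl | h
  · rw [eval_zero_reflect_subspacePoly hT hα]
    simp
  · rw [eval_reflect_subspacePoly hT hα h]
    have h0 : 0 < ‖u‖ := norm_pos_iff.2 h
    have : Finite (LinearMap.range T) := Set.finite_range T
    have hcard : Nat.card (LinearMap.range T) = Fintype.card U := by
      rw [← Nat.card_congr (LinearEquiv.ofInjective T hT).toEquiv, Nat.card_eq_fintype_card]
    have := norm_vanishing_div_sub_one_sq_le (LinearMap.range T) (M := M) (x := u⁻¹)
      (by rw [norm_inv]; positivity) hM (by rw [norm_inv, ← one_div, le_div_iff₀ h0]; exact hu)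
      (by rintro _ ⟨v, rfl⟩; exact hTM v)
    rw [hcard, inv_pow, div_inv_eq_mul, norm_inv, div_inv_eq_mul, mul_comm (vanishing _ _)] at this
    exact this

/-! ### Lattices -/

section Lattice

/-- The absolute value of the `k[X]`-algebra `K` restricts to `|a| = q ^ deg a`. -/
class DegreeNorm (k K : Type*) [Field k] [Fintype k] [NormedField K] [Algebra k[X] K] : Prop where
  norm_algebraMap : ∀ a : k[X], a ≠ 0 →
    ‖algebraMap k[X] K a‖ = (Fintype.card k : ℝ) ^ a.natDegree

variable {k K : Type*} [Field k] [Fintype k]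

instance finite_degreeLT (d : ℕ) : Finite (degreeLT k d) :=
  Finite.of_equiv _ (degreeLTEquiv k d).symm.toEquiv

instance fintype_degreeLT (d : ℕ) : Fintype (degreeLT k d) := Fintype.ofFinite _

theorem card_degreeLT (d : ℕ) : Fintype.card (degreeLT k d) = Fintype.card k ^ d := by
  rw [Fintype.card_congr (degreeLTEquiv k d).toEquiv, Fintype.card_fun, Fintype.card_fin]

theorem card_fun_degreeLT (s d : ℕ) :
    Fintype.card (Fin s → degreeLT k d) = Fintype.card k ^ (s * d) := by
  rw [Fintype.card_fun, card_degreeLT, Fintype.card_fin, ← pow_mul, mul_comm]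

omit [Fintype k] in
theorem mem_degreeLT_natDegree {a b : k[X]} (ha : a ≠ 0) :
    b ∈ degreeLT k a.natDegree ↔ b.degree < a.degree := by
  rw [mem_degreeLT, degree_eq_natDegree ha]

theorem finite_natDegree_lt (d : ℕ) : {a : k[X] | a.natDegree < d}.Finite := by
  refine (show (degreeLT k d : Set k[X]).Finite from finite_degreeLT d).subset fun a ha => ?_
  rw [SetLike.mem_coe, mem_degreeLT]
  exact degree_le_natDegree.trans_lt (by exact_mod_cast ha)

variable [NormedField K] [Algebra k[X] K]

/-- The linear combination of `ω` with coefficients `b`. -/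
def comb {s : ℕ} (ω : Fin s → K) : (Fin s → k[X]) →ₗ[k[X]] K := Fintype.linearCombination k[X] ω

omit [Fintype k] in
theorem comb_apply {s : ℕ} (ω : Fin s → K) (b : Fin s → k[X]) : comb ω b = ∑ j, b j • ω j := rfl

/-- The lattice spanned by `ω`. -/
def spanLattice {s : ℕ} (ω : Fin s → K) : Submodule k[X] K := Submodule.span k[X] (Set.range ω)

omit [Fintype k] in
theorem mem_spanLattice {s : ℕ} {ω : Fin s → K} {x : K} :
    x ∈ spanLattice (k := k) ω ↔ ∃ b : Fin s → k[X], comb ω b = x := by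
  rw [spanLattice, Submodule.mem_span_range_iff_exists_fun]
  rfl

omit [Fintype k] in
theorem comb_mem {s : ℕ} {ω : Fin s → K} (b : Fin s → k[X]) :
    comb ω b ∈ spanLattice (k := k) ω := mem_spanLattice.2 ⟨b, rfl⟩

/-- The lower bound `η |b| ≤ |∑ b_j ω_j|` for all `b` with entries in `k[X]`. -/
structure IsLatticeBasis (k : Type*) {K : Type*} [Field k] [NormedField K] [Algebra k[X] K] {s : ℕ}
    (ω : Fin s → K) (η : ℝ) : Prop where
  pos : 0 < η
  le_norm : ∀ (b : Fin s → k[X]) (j : Fin s), η * ‖algebraMap k[X] K (b j)‖ ≤ ‖comb ω b‖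

variable [DegreeNorm k K]

variable (K) in
theorem algebraMap_ne_zero_of_ne {a : k[X]} (ha : a ≠ 0) : algebraMap k[X] K a ≠ 0 := by
  rw [← norm_pos_iff, DegreeNorm.norm_algebraMap a ha]
  have := Fintype.card_pos (α := k)
  positivity

variable (K) in
theorem one_le_norm_algebraMap {a : k[X]} (ha : a ≠ 0) : 1 ≤ ‖algebraMap k[X] K a‖ := by
  rw [DegreeNorm.norm_algebraMap a ha]
  exact one_le_pow₀ (by exact_mod_cast Fintype.card_pos)

variable {s : ℕ} {ω : Fin s → K} {η : ℝ}

theorem IsLatticeBasis.injective (hω : IsLatticeBasis k ω η) :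
    Function.Injective (comb (k := k) ω) := by
  rw [← LinearMap.ker_eq_bot, LinearMap.ker_eq_bot']
  intro b hb
  ext1 j
  by_contra hj
  have h := hω.le_norm b j
  rw [hb, norm_zero] at h
  have := one_le_norm_algebraMap K hj
  nlinarith [hω.pos]

theorem IsLatticeBasis.le_norm_of_ne_zero (hω : IsLatticeBasis k ω η) {b : Fin s → k[X]}
    (hb : b ≠ 0) : η ≤ ‖comb ω b‖ := by
  obtain ⟨j, hj⟩ := Function.ne_iff.1 hb
  have := one_le_norm_algebraMap K hj
  have := hω.le_norm b j
  nlinarith [hω.pos]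

theorem IsLatticeBasis.mem_degreeLT (hω : IsLatticeBasis k ω η) {D : ℕ} {b : Fin s → k[X]}
    (h : ‖comb ω b‖ < η * (Fintype.card k : ℝ) ^ D) (j : Fin s) : b j ∈ degreeLT k D := by
  by_contra hj
  have hb0 : b j ≠ 0 := fun h0 => hj (by rw [h0]; exact Submodule.zero_mem _)
  have hD : D ≤ (b j).natDegree := by
    by_contra hlt
    apply hj
    rw [Polynomial.mem_degreeLT, degree_eq_natDegree hb0]
    exact_mod_cast not_le.1 hlt
  have h1 := hω.le_norm b j
  rw [DegreeNorm.norm_algebraMap _ hb0] at h1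
  have h2 : (Fintype.card k : ℝ) ^ D ≤ (Fintype.card k : ℝ) ^ (b j).natDegree :=
    pow_le_pow_right₀ (by exact_mod_cast Fintype.card_pos) hD
  nlinarith [hω.pos]

variable [Algebra k K]

variable [IsScalarTower k k[X] K]

/-- The lattice spanned by `ω`, as a vector space over the constant field. -/
def constLattice (k : Type*) {K : Type*} [Field k] [NormedField K] [Algebra k[X] K] [Algebra k K]
    [IsScalarTower k k[X] K] {s : ℕ} (ω : Fin s → K) : Submodule k K :=
  (spanLattice (k := k) ω).restrictScalars k

/-- Elements of norm below η q^D have coefficients of degree below D, of which there are finitely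
many. -/
theorem IsLatticeBasis.isDiscrete (hω : IsLatticeBasis k ω η) :
    IsDiscreteSubspace (constLattice k ω) := by
  intro B
  have hq : (1 : ℝ) < Fintype.card k := by exact_mod_cast Fintype.one_lt_card
  obtain ⟨D, hD⟩ := pow_unbounded_of_one_lt (B / η) hq
  rw [div_lt_iff₀ hω.pos, mul_comm] at hD
  refine Set.Finite.of_injOn (f := fun l : constLattice k ω => (l : K))
    (t := Set.range fun u : Fin s → degreeLT k D => comb ω fun j => (u j : k[X])) ?_
    Subtype.val_injective.injOn (Set.toFinite _)
  intro l hl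
  obtain ⟨b, hb⟩ := mem_spanLattice.1 l.2
  have hl : ‖(l : K)‖ ≤ B := hl
  rw [← hb] at hl
  exact ⟨fun j => ⟨b j, hω.mem_degreeLT (hl.trans_lt hD) j⟩, hb⟩

/-- The subspace `a⁻¹ L`. -/
def divLattice (L : Submodule k K) (a : k[X]) : Submodule k K :=
  L.comap (LinearMap.mulLeft k (algebraMap k[X] K a))

omit [Fintype k] [DegreeNorm k K] [IsScalarTower k k[X] K] in
theorem mem_divLattice {L : Submodule k K} {a : k[X]} {x : K} :
    x ∈ divLattice L a ↔ algebraMap k[X] K a * x ∈ L := Iff.rfl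

/-- The combination `a⁻¹ ∑ u_j ω_j`. -/
def torsionRep (ω : Fin s → K) (a : k[X]) : (Fin s → degreeLT k a.natDegree) →ₗ[k] K where
  toFun u := (algebraMap k[X] K a)⁻¹ * comb ω fun j => (u j : k[X])
  map_add' u v := by
    rw [← mul_add, ← map_add]
    rfl
  map_smul' c u := by
    rw [RingHom.id_apply, ← mul_smul_comm, ← algebraMap_smul k[X] c (comb ω _), ← map_smul]
    congr 2
    ext1 j
    simp [Polynomial.smul_eq_C_mul]

theorem mul_torsionRep {a : k[X]} (ha : a ≠ 0) (u : Fin s → degreeLT k a.natDegree) :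
    algebraMap k[X] K a * torsionRep ω a u = comb ω fun j => (u j : k[X]) := by
  have := algebraMap_ne_zero_of_ne K ha
  exact mul_inv_cancel_left₀ this _

/-- After multiplication by a, each u_j - v_j is divisible by a and of smaller degree. With the
division in `exists_torsionRep_sub_mem`, remainders modulo a represent a⁻¹L/L exactly once. -/
theorem IsLatticeBasis.eq_of_torsionRep_sub_mem (hω : IsLatticeBasis k ω η) {a : k[X]} (ha : a ≠ 0)
    {u v : Fin s → degreeLT k a.natDegree}
    (h : torsionRep ω a u - torsionRep ω a v ∈ spanLattice (k := k) ω) : u = v := by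
  obtain ⟨c, hc⟩ := mem_spanLattice.1 h
  have h1 : comb ω (a • c) = comb ω ((fun j => (u j : k[X])) - fun j => (v j : k[X])) := by
    rw [map_sub, map_smul, hc, Algebra.smul_def, mul_sub, mul_torsionRep ha, mul_torsionRep ha]
  have h2 := hω.injective h1
  ext1 j
  apply Subtype.ext
  rw [← sub_eq_zero]
  have h3 : a * c j = (u j : k[X]) - v j := congrFun h2 j
  refine eq_zero_of_dvd_of_degree_lt (p := a) ⟨c j, h3.symm⟩ ?_
  exact (mem_degreeLT_natDegree ha).1 (Submodule.sub_mem _ (u j).2 (v j).2)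

theorem exists_torsionRep_sub_mem {a : k[X]} (ha : a ≠ 0) {x : K}
    (hx : algebraMap k[X] K a * x ∈ spanLattice (k := k) ω) :
    ∃ u, torsionRep ω a u - x ∈ spanLattice (k := k) ω := by
  obtain ⟨b, hb⟩ := mem_spanLattice.1 hx
  refine ⟨fun j => ⟨b j % a, (mem_degreeLT_natDegree ha).2 (EuclideanDomain.mod_lt _ ha)⟩, ?_⟩
  refine mem_spanLattice.2 ⟨fun j => -(b j / a), ?_⟩
  have h0 := algebraMap_ne_zero_of_ne K ha
  apply mul_left_cancel₀ h0
  rw [mul_sub, mul_torsionRep ha, ← hb, ← Algebra.smul_def, ← map_smul, ← map_sub]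
  congr 1
  ext1 j
  change a * -(b j / a) = b j % a - b j
  linear_combination -(EuclideanDomain.div_add_mod (b j) a)

/-- Every element of `a⁻¹ L` is the difference of a representative and an element of `L`. -/
def IsLatticeBasis.divLatticeEquiv (hω : IsLatticeBasis k ω η) {a : k[X]} (ha : a ≠ 0) :
    (Fin s → degreeLT k a.natDegree) × constLattice k ω ≃ divLattice (constLattice k ω) a :=
  Equiv.ofBijective (fun p => ⟨torsionRep ω a p.1 - p.2, by
      rw [mem_divLattice, mul_sub, mul_torsionRep ha, ← Algebra.smul_def]
      exact Submodule.sub_mem _ (comb_mem (ω := ω) _)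
        (Submodule.smul_mem (spanLattice (k := k) ω) a p.2.2)⟩) <| by
    constructor
    · rintro ⟨u, l⟩ ⟨v, m⟩ h
      have h : torsionRep ω a u - l = torsionRep ω a v - m := congrArg Subtype.val h
      have huv : u = v := by
        apply hω.eq_of_torsionRep_sub_mem ha
        have : torsionRep ω a u - torsionRep ω a v = l - m := by linear_combination h
        rw [this]
        exact Submodule.sub_mem _ l.2 m.2
      subst huv
      have : (l : K) = m := by linear_combination -h
      rw [Subtype.ext this]
    · rintro ⟨x, hx⟩
      obtain ⟨u, hu⟩ := exists_torsionRep_sub_mem ha (mem_divLattice.1 hx)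
      exact ⟨(u, ⟨_, hu⟩), Subtype.ext (by simp)⟩

end Lattice

/-! ### Exponential function and Drinfeld module of a lattice -/

section LatticeExponential

variable {k K : Type*} [Field k] [Fintype k] [NormedField K] [IsUltrametricDist K] [CompleteSpace K]
  [Algebra k[X] K] [Algebra k K] [IsScalarTower k k[X] K] [DegreeNorm k K]
  {s : ℕ} {ω : Fin s → K} {η : ℝ}

/-- The exponential function of a discrete subspace as a linear map. -/
def IsDiscreteSubspace.expMap {L : Submodule k K} (hL : IsDiscreteSubspace L) : K →ₗ[k] K :=
  hL.exists_expo_eq.choose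

omit [Algebra k[X] K] [IsScalarTower k k[X] K] [DegreeNorm k K] in
theorem IsDiscreteSubspace.expMap_apply {L : Submodule k K} (hL : IsDiscreteSubspace L) (x : K) :
    hL.expMap x = expo L x := (hL.exists_expo_eq.choose_spec x).symm

omit [IsUltrametricDist K] [CompleteSpace K] [IsScalarTower k k[X] K] in
theorem isDiscrete_divLattice {L : Submodule k K} (hL : IsDiscreteSubspace L) {a : k[X]}
    (ha : a ≠ 0) : IsDiscreteSubspace (divLattice L a) := by
  intro B
  have h0 := algebraMap_ne_zero_of_ne K ha
  refine Set.Finite.of_injOn (f := fun x : divLattice L a => (⟨algebraMap k[X] K a * x, x.2⟩ : L))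
    (t := {l : L | ‖(l : K)‖ ≤ ‖algebraMap k[X] K a‖ * B}) ?_ ?_ (hL _)
  · intro x hx
    change ‖algebraMap k[X] K a * x‖ ≤ _
    rw [norm_mul]
    gcongr
    exact hx
  · intro x _ y _ h
    have h : algebraMap k[X] K a * x = algebraMap k[X] K a * y := congrArg Subtype.val h
    exact Subtype.ext (mul_left_cancel₀ h0 h)

-- Multiplication by a maps a⁻¹L onto L and preserves the ratios x / l; only the factor of the zero
-- vector changes, by a.
omit [IsScalarTower k k[X] K] in
theorem expo_mul {L : Submodule k K} (hL : IsDiscreteSubspace L) {a : k[X]} (ha : a ≠ 0) (x : K) :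
    expo L (algebraMap k[X] K a * x) = algebraMap k[X] K a * expo (divLattice L a) x := by
  classical
  have h0 := algebraMap_ne_zero_of_ne K ha
  let e : divLattice L a ≃ L :=
    { toFun := fun y => ⟨algebraMap k[X] K a * y, y.2⟩
      invFun := fun l => ⟨(algebraMap k[X] K a)⁻¹ * l, by
        rw [mem_divLattice, mul_inv_cancel_left₀ h0]; exact l.2⟩
      left_inv := fun y => Subtype.ext (inv_mul_cancel_left₀ h0 _)
      right_inv := fun l => Subtype.ext (mul_inv_cancel_left₀ h0 _) }
  have h1 := (Equiv.hasProd_iff e).2 (hL.hasProd_expo (algebraMap k[X] K a * x))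
  have h2 := (hasProd_ite_eq (0 : divLattice L a) (algebraMap k[X] K a)).mul
    ((isDiscrete_divLattice hL ha).hasProd_expo x)
  refine h1.unique (h2.congr_fun fun y => ?_)
  change expFactor (algebraMap k[X] K a * x) (algebraMap k[X] K a * y) = _
  by_cases hy : y = 0
  · simp [hy]
  · have hy0 : (y : K) ≠ 0 := fun h => hy (Subtype.ext h)
    rw [if_neg hy, one_mul, expFactor_of_ne hy0, expFactor_of_ne (mul_ne_zero h0 hy0),
      mul_div_mul_left _ _ h0]

namespace IsLatticeBasis

variable (hω : IsLatticeBasis k ω η)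
include hω

/-- The parametrisation of the zeros of `φ_a` by `e_L` of the representatives of `a⁻¹ L / L`. -/
def torsionMap (a : k[X]) : (Fin s → degreeLT k a.natDegree) →ₗ[k] K :=
  hω.isDiscrete.expMap ∘ₗ torsionRep ω a

theorem torsionMap_apply (a : k[X]) (u : Fin s → degreeLT k a.natDegree) :
    hω.torsionMap a u = expo (constLattice k ω) (torsionRep ω a u) :=
  hω.isDiscrete.expMap_apply _

theorem torsionMap_injective {a : k[X]} (ha : a ≠ 0) : Function.Injective (hω.torsionMap a) := by
  intro u v h
  rw [torsionMap_apply, torsionMap_apply, ← sub_eq_zero, ← hω.isDiscrete.expo_sub,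
    hω.isDiscrete.expo_eq_zero_iff] at h
  exact hω.eq_of_torsionRep_sub_mem ha h

/-- The Drinfeld module of the lattice spanned by `ω`. -/
def phi (a : k[X]) : K[X] :=
  open Classical in subspacePoly (algebraMap k[X] K a) (hω.torsionMap a)

/-- Grouping e_{a⁻¹L} by the cosets of L makes it a finite product in e_L(x), which is φ_a up to the
factor a supplied by `expo_mul`. -/
theorem eval_phi_expo {a : k[X]} (ha : a ≠ 0) (x : K) :
    (hω.phi a).eval (expo (constLattice k ω) x) =
      expo (constLattice k ω) (algebraMap k[X] K a * x) := by
  classical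
  have hL := hω.isDiscrete
  have h := hL.hasProd_expo_of_equiv (isDiscrete_divLattice hL ha) (torsionRep ω a)
    (map_zero _) (hω.divLatticeEquiv ha) (fun p => rfl) x
  have h2 := h.unique (hasProd_fintype _)
  rw [expo_mul hL ha, h2, phi, subspacePoly, prod_eq_mul_prod_ne_zero fun u =>
    expFactor (expo (constLattice k ω) x) (expo (constLattice k ω) (torsionRep ω a u)),
    map_zero, hL.expo_eq_zero_iff.2 (Submodule.zero_mem _), expFactor_zero]
  simp only [eval_mul, eval_C, eval_X, eval_prod, eval_sub, eval_one]
  rw [mul_assoc]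
  congr 2
  refine Finset.prod_congr rfl fun u _ => ?_
  have hu : expo (constLattice k ω) (torsionRep ω a u) ≠ 0 := by
    rw [← hω.torsionMap_apply]
    exact fun h => u.2 (hω.torsionMap_injective ha (by rw [h, map_zero]))
  rw [expFactor_of_ne hu, torsionMap_apply]
  ring

/-- The bound does not depend on a: the representatives have norm at most R for every a, and at most
q^(sD) lattice elements are shorter than R. -/
theorem norm_torsionMap_le {R : ℝ} (hR : ∀ j, ‖ω j‖ ≤ R) (hR0 : 0 ≤ R) {D : ℕ}
    (hD : R / η ≤ (Fintype.card k : ℝ) ^ D) {a : k[X]} (ha : a ≠ 0)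
    (u : Fin s → degreeLT k a.natDegree) :
    ‖hω.torsionMap a u‖ ≤ R * ((Fintype.card k : ℝ) ^ D) ^ Fintype.card k ^ (s * D) := by
  classical
  have hq : (1 : ℝ) ≤ Fintype.card k := by exact_mod_cast Fintype.card_pos
  have hrep : ‖torsionRep ω a u‖ ≤ R := by
    change ‖(algebraMap k[X] K a)⁻¹ * comb ω (fun j => (u j : k[X]))‖ ≤ R
    rw [comb_apply, Finset.mul_sum]
    refine IsUltrametricDist.norm_sum_le_of_forall_le_of_nonneg hR0 fun j _ => ?_
    have h1 : ‖(algebraMap k[X] K a)⁻¹ * algebraMap k[X] K (u j : k[X])‖ ≤ 1 := by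
      rw [norm_mul, norm_inv]
      rcases eq_or_ne (u j : k[X]) 0 with h0 | h0
      · rw [h0]; simp
      · have h2 := (mem_degreeLT_natDegree ha).1 (u j).2
        rw [DegreeNorm.norm_algebraMap a ha, DegreeNorm.norm_algebraMap _ h0,
          inv_mul_le_one₀ (by positivity)]
        exact pow_le_pow_right₀ hq (natDegree_le_natDegree h2.le)
    rw [Algebra.smul_def, ← mul_assoc, norm_mul]
    have := hR j
    nlinarith [norm_nonneg (ω j)]
  -- The image of `g` contains every lattice element of norm below R, because R ≤ η q^D.
  let g : (Fin s → degreeLT k D) → constLattice k ω := fun v =>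
    ⟨comb ω fun j => (v j : k[X]), comb_mem _⟩
  have hS := hω.isDiscrete.norm_expo_le hω.pos (one_le_pow₀ hq) hD (Finset.univ.image g)
    (fun l hl => ?_) (fun l hl => ?_) hrep
  · rw [torsionMap_apply]
    refine hS.trans ?_
    gcongr
    · exact one_le_pow₀ hq
    · rw [← card_fun_degreeLT, ← Finset.card_univ]
      exact Finset.card_image_le
  · by_contra hlt
    rw [not_le] at hlt
    obtain ⟨b, hb⟩ := mem_spanLattice.1 l.2
    apply hl
    rw [Finset.mem_image]
    rw [div_le_iff₀ hω.pos, mul_comm] at hD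
    exact ⟨fun j => ⟨b j, hω.mem_degreeLT (by rw [hb]; exact hlt.trans_le hD) j⟩,
      Finset.mem_univ _, Subtype.ext hb⟩
  · obtain ⟨b, hb⟩ := mem_spanLattice.1 l.2
    rw [← hb]
    apply hω.le_norm_of_ne_zero
    rintro rfl
    exact hl (Subtype.ext (by rw [← hb, map_zero]; rfl))

end IsLatticeBasis

/-- The polynomial `φ_a` with its zeros indexed by the nonzero elements of `a⁻¹ L / L`. -/
def quotientPoly (L : Submodule k[X] K) (a : k[X]) : K[X] :=
  C (algebraMap k[X] K a) * X *
    ∏ᶠ z : {z : K ⧸ L // a • z = 0 ∧ z ≠ 0}, (1 - C (expo (L.restrictScalars k) z.1.out)⁻¹ * X)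

/-- The index type is finite, so the `finprod` does not take its default value, and the choice made
by `out` is harmless because e_L is L-periodic. -/
theorem IsLatticeBasis.quotientPoly_eq (hω : IsLatticeBasis k ω η) {a : k[X]} (ha : a ≠ 0) :
    quotientPoly (spanLattice (k := k) ω) a = hω.phi a := by
  classical
  rw [quotientPoly, phi, subspacePoly]
  congr 1
  rw [← finprod_eq_prod_of_fintype]
  have hmem : ∀ u,
      a • (Submodule.Quotient.mk (torsionRep ω a u) : K ⧸ spanLattice (k := k) ω) = 0 := by
    intro u
    rw [← Submodule.Quotient.mk_smul, Submodule.Quotient.mk_eq_zero, Algebra.smul_def,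
      mul_torsionRep ha]
    exact comb_mem _
  have hne : ∀ u, u ≠ 0 →
      (Submodule.Quotient.mk (torsionRep ω a u) : K ⧸ spanLattice (k := k) ω) ≠ 0 := by
    intro u hu h
    rw [Submodule.Quotient.mk_eq_zero] at h
    apply hu
    apply hω.eq_of_torsionRep_sub_mem ha
    rwa [map_zero, sub_zero]
  refine (finprod_eq_of_bijective (fun u : {u : Fin s → degreeLT k a.natDegree // u ≠ 0} =>
    (⟨Submodule.Quotient.mk (torsionRep ω a u), hmem u, hne u u.2⟩ :
      {z : K ⧸ spanLattice (k := k) ω // a • z = 0 ∧ z ≠ 0})) ⟨?_, ?_⟩ fun u => ?_).symm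
  · intro u v h
    have h := congrArg Subtype.val h
    simp only at h
    rw [Submodule.Quotient.eq] at h
    exact Subtype.ext (hω.eq_of_torsionRep_sub_mem ha h)
  · rintro ⟨z, hz, hz0⟩
    obtain ⟨x, rfl⟩ := Submodule.Quotient.mk_surjective _ z
    rw [← Submodule.Quotient.mk_smul, Submodule.Quotient.mk_eq_zero, Algebra.smul_def] at hz
    obtain ⟨u, hu⟩ := exists_torsionRep_sub_mem ha hz
    rw [← Submodule.Quotient.eq] at hu
    refine ⟨⟨u, ?_⟩, Subtype.ext hu⟩
    rintro rfl
    apply hz0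
    rw [← hu, map_zero, Submodule.Quotient.mk_zero]
  · rw [hω.torsionMap_apply]
    congr 4
    rw [← sub_eq_zero]
    change expo (constLattice k ω) _ - expo (constLattice k ω) _ = 0
    rw [← hω.isDiscrete.expo_sub, hω.isDiscrete.expo_eq_zero_iff]
    change _ ∈ spanLattice (k := k) ω
    rw [← Submodule.Quotient.eq]
    exact (Quotient.out_eq' _).symm

end LatticeExponential

/-! ### Splitting off the first basis vector -/

section ProductFormula

open Filter

variable {k K : Type*} [Field k] [Fintype k] [NormedField K] [IsUltrametricDist K] [CompleteSpace K]
  [Algebra k[X] K] [Algebra k K] [IsScalarTower k k[X] K] [DegreeNorm k K] {s : ℕ}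

namespace IsLatticeBasis

section Rank

variable {ω : Fin s → K} {η : ℝ} (hω : IsLatticeBasis k ω η)
include hω

theorem leadingCoeff_phi_ne_zero {a : k[X]} (ha : a ≠ 0) : (hω.phi a).leadingCoeff ≠ 0 := by
  classical
  exact leadingCoeff_subspacePoly_ne_zero (hω.torsionMap_injective ha)
    (algebraMap_ne_zero_of_ne K ha)

theorem natDegree_phi {a : k[X]} (ha : a ≠ 0) :
    (hω.phi a).natDegree = Fintype.card k ^ (s * a.natDegree) := by
  classical
  rw [← card_fun_degreeLT]
  exact natDegree_subspacePoly (hω.torsionMap_injective ha) (algebraMap_ne_zero_of_ne K ha)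

theorem leadingCoeff_phi_of_natDegree_eq_zero {a : k[X]} (ha : a ≠ 0) (h : a.natDegree = 0) :
    (hω.phi a).leadingCoeff = algebraMap k[X] K a := by
  classical
  have hU : Subsingleton (Fin s → degreeLT k a.natDegree) := by
    rw [← Fintype.card_le_one_iff_subsingleton, card_fun_degreeLT, h, mul_zero, pow_zero]
  have : IsEmpty {u : Fin s → degreeLT k a.natDegree // u ≠ 0} := ⟨fun u => u.2 (hU.elim _ _)⟩
  have := leadingCoeff_subspacePoly_mul_prod (hω.torsionMap_injective ha)
    (α := algebraMap k[X] K a)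
  rwa [Fintype.prod_empty, mul_one] at this

/-- The value at `u` of `X ^ N φ_a(X⁻¹) / Δ_a`, where `N` is the degree of `φ_a`. -/
def unitFactor (u : K) (a : k[X]) : K :=
  (C (hω.phi a).leadingCoeff⁻¹ *
    (hω.phi a).reflect (Fintype.card k ^ (s * a.natDegree))).eval u

theorem eval_phi_eq_unitFactor {a : k[X]} (ha : a ≠ 0) {y : K} (hy : y ≠ 0) :
    (hω.phi a).eval y = (hω.phi a).leadingCoeff * y ^ (Fintype.card k ^ (s * a.natDegree)) *
      hω.unitFactor y⁻¹ a := by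
  classical
  have h := eval_reflect_subspacePoly (hω.torsionMap_injective ha)
    (algebraMap_ne_zero_of_ne K ha) (inv_ne_zero hy)
  rw [card_fun_degreeLT] at h
  rw [unitFactor, phi, eval_subspacePoly (hω.torsionMap_injective ha), h, inv_inv, inv_pow]
  field_simp

theorem norm_unitFactor_sub_one_sq_le {R : ℝ} (hR : ∀ j, ‖ω j‖ ≤ R) (hR0 : 0 ≤ R) {D : ℕ}
    (hD : R / η ≤ (Fintype.card k : ℝ) ^ D) {a : k[X]} (ha : a ≠ 0) {u : K}
    (hu : R * ((Fintype.card k : ℝ) ^ D) ^ Fintype.card k ^ (s * D) * ‖u‖ ≤ 1) :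
    ‖hω.unitFactor u a - 1‖ ^ 2 ≤
      (R * ((Fintype.card k : ℝ) ^ D) ^ Fintype.card k ^ (s * D) * ‖u‖) ^
        (Fintype.card k ^ (s * a.natDegree)) := by
  classical
  have := norm_eval_reflect_subspacePoly_sub_one_sq_le (hω.torsionMap_injective ha)
    (algebraMap_ne_zero_of_ne K ha) (by positivity) (hω.norm_torsionMap_le hR hR0 hD ha) hu
  rwa [card_fun_degreeLT] at this

end Rank

end IsLatticeBasis

variable {ω : Fin (s + 1) → K} {η : ℝ}

omit [Fintype k] [IsUltrametricDist K] [CompleteSpace K] [Algebra k K] [IsScalarTower k k[X] K]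
  [DegreeNorm k K] in
theorem comb_cons (a : k[X]) (b : Fin s → k[X]) :
    comb ω (Fin.cons a b : Fin (s + 1) → k[X]) =
      algebraMap k[X] K a * ω 0 + comb (Fin.tail ω) b := by
  rw [comb_apply, Fin.sum_univ_succ, comb_apply, ← Algebra.smul_def]
  rfl

/-- The value `e_L(a ω₁)` for the lattice `L` spanned by all entries of `ω` but the first. -/
def expMul (ω : Fin (s + 1) → K) (a : k[X]) : K :=
  expo (constLattice k (Fin.tail ω)) (algebraMap k[X] K a * ω 0)

namespace IsLatticeBasis

section

variable (hω : IsLatticeBasis k ω η)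
include hω

omit [Fintype k] [IsUltrametricDist K] [CompleteSpace K] [Algebra k K] [IsScalarTower k k[X] K]
  [DegreeNorm k K] in
theorem tail : IsLatticeBasis k (Fin.tail ω) η where
  pos := hω.pos
  le_norm b j := by
    have := hω.le_norm (Fin.cons 0 b) j.succ
    rwa [comb_cons, map_zero, zero_mul, zero_add, Fin.cons_succ] at this

omit [IsUltrametricDist K] [CompleteSpace K] [Algebra k K] [IsScalarTower k k[X] K] in
theorem mul_mem_tail_iff {a : k[X]} :
    algebraMap k[X] K a * ω 0 ∈ spanLattice (k := k) (Fin.tail ω) ↔ a = 0 := by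
  constructor
  · intro h
    obtain ⟨b, hb⟩ := mem_spanLattice.1 h
    have h1 : comb ω (Fin.cons a (-b) : Fin (s + 1) → k[X]) = comb (k := k) ω 0 := by
      rw [comb_cons, map_neg, map_zero, hb, add_neg_cancel]
    have := congrFun (hω.injective h1) 0
    simpa using this
  · rintro rfl
    rw [map_zero, zero_mul]
    exact Submodule.zero_mem _

theorem expMul_eq_zero_iff {a : k[X]} : expMul ω a = 0 ↔ a = 0 := by
  rw [expMul, hω.tail.isDiscrete.expo_eq_zero_iff]
  exact hω.mul_mem_tail_iff

theorem expMul_sub (a b : k[X]) : expMul ω (a - b) = expMul ω a - expMul ω b := by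
  rw [expMul, expMul, expMul, map_sub, sub_mul, hω.tail.isDiscrete.expo_sub]

theorem expMul_injective : Function.Injective (expMul (k := k) ω) := by
  intro a b h
  rw [← sub_eq_zero, ← hω.expMul_sub, hω.expMul_eq_zero_iff, sub_eq_zero] at h
  exact h

theorem expMul_C_mul (c : k) (a : k[X]) : expMul ω (C c * a) = algebraMap k K c * expMul ω a := by
  have h : algebraMap k[X] K (C c * a) * ω 0 = c • (algebraMap k[X] K a * ω 0) := by
    rw [map_mul, mul_assoc, ← Polynomial.algebraMap_eq, ← IsScalarTower.algebraMap_apply,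
      Algebra.smul_def]
  rw [expMul, h, ← hω.tail.isDiscrete.expMap_apply, map_smul, hω.tail.isDiscrete.expMap_apply,
    Algebra.smul_def, expMul]

theorem eval_phi_expMul {a : k[X]} (ha : a ≠ 0) (b : k[X]) :
    (hω.tail.phi a).eval (expMul ω b) = expMul ω (a * b) := by
  rw [expMul, hω.tail.eval_phi_expo ha, expMul, map_mul, mul_assoc]

/-- Every element of the lattice is uniquely `a ω₁ - l` with `l` in the smaller lattice. -/
def tailEquiv : k[X] × constLattice k (Fin.tail ω) ≃ constLattice k ω :=
  Equiv.ofBijective (fun p => ⟨algebraMap k[X] K p.1 * ω 0 - p.2, by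
      obtain ⟨b, hb⟩ := mem_spanLattice.1 p.2.2
      refine mem_spanLattice.2 ⟨Fin.cons p.1 (-b), ?_⟩
      rw [comb_cons, map_neg, hb, sub_eq_add_neg]⟩) <| by
    constructor
    · rintro ⟨a, l⟩ ⟨b, m⟩ h
      have h : algebraMap k[X] K a * ω 0 - l = algebraMap k[X] K b * ω 0 - m :=
        congrArg Subtype.val h
      have hab : a = b := by
        rw [← sub_eq_zero, ← hω.mul_mem_tail_iff, map_sub, sub_mul]
        have : algebraMap k[X] K a * ω 0 - algebraMap k[X] K b * ω 0 = l - m := by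
          linear_combination h
        rw [this]
        exact Submodule.sub_mem _ l.2 m.2
      subst hab
      have : (l : K) = m := by linear_combination -h
      rw [Subtype.ext this]
    · rintro ⟨x, hx⟩
      obtain ⟨b, hb⟩ := mem_spanLattice.1 hx
      refine ⟨(b 0, ⟨-comb (Fin.tail ω) (Fin.tail b), Submodule.neg_mem _ (comb_mem _)⟩),
        Subtype.ext ?_⟩
      change _ - -_ = x
      rw [sub_neg_eq_add, ← comb_cons, Fin.cons_self_tail, hb]

theorem hasProd_expo_cons (x : K) :
    HasProd (fun a : k[X] => expFactor (expo (constLattice k (Fin.tail ω)) x) (expMul ω a))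
      (expo (constLattice k ω) x) :=
  hω.tail.isDiscrete.hasProd_expo_of_equiv hω.isDiscrete (fun a : k[X] => algebraMap k[X] K a * ω 0)
    (i₀ := 0) (by rw [map_zero, zero_mul]) hω.tailEquiv (fun _ => rfl) x

/-- The identity φ'_{pa-c} = φ'_p ∘ φ'_a - cX holds at the infinitely many points e'(bω₁). As s and
deg p are positive, the composite has degree above 1, so cX does not affect the leading coefficient.
-/
theorem leadingCoeff_phi_mul_sub (hs : 0 < s) {p a c : k[X]} (hp : p ≠ 0) (ha : a ≠ 0)
    (hpd : 0 < p.natDegree) (hc : c.natDegree = 0) (hpac : p * a - c ≠ 0) :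
    (hω.tail.phi (p * a - c)).leadingCoeff =
      (hω.tail.phi p).leadingCoeff *
        (hω.tail.phi a).leadingCoeff ^ (Fintype.card k ^ (s * p.natDegree)) := by
  have hq := Fintype.one_lt_card (α := k)
  obtain ⟨c, rfl⟩ := natDegree_eq_zero.1 hc
  have key : hω.tail.phi (p * a - C c) =
      (hω.tail.phi p).comp (hω.tail.phi a) - C (algebraMap k K c) * X := by
    refine eq_of_infinite_eval_eq _ _ ((Set.infinite_range_of_injective
      hω.expMul_injective).mono ?_)
    rintro _ ⟨b, rfl⟩
    change eval _ _ = eval _ _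
    rw [hω.eval_phi_expMul hpac, eval_sub, eval_comp, hω.eval_phi_expMul ha, hω.eval_phi_expMul hp,
      sub_mul, hω.expMul_sub, hω.expMul_C_mul, mul_assoc, eval_mul, eval_C, eval_X]
  have hpdeg : (hω.tail.phi p).natDegree ≠ 0 := by
    rw [hω.tail.natDegree_phi hp]; positivity
  have hadeg : (hω.tail.phi a).natDegree ≠ 0 := by
    rw [hω.tail.natDegree_phi ha]; positivity
  rw [key, leadingCoeff_sub_of_degree_lt, leadingCoeff_comp hadeg, hω.tail.natDegree_phi hp]
  refine (degree_C_mul_X_le _).trans_lt ?_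
  have h1 : 1 < ((hω.tail.phi p).comp (hω.tail.phi a)).natDegree := by
    rw [natDegree_comp, hω.tail.natDegree_phi hp]
    have h2 : 1 < Fintype.card k ^ (s * p.natDegree) := Nat.one_lt_pow (by positivity) hq
    exact h2.trans_le (Nat.le_mul_of_pos_right _ (Nat.pos_of_ne_zero hadeg))
  have h3 : ((hω.tail.phi p).comp (hω.tail.phi a)) ≠ 0 := by
    intro h
    rw [h, natDegree_zero] at h1
    omega
  rw [degree_eq_natDegree h3]
  exact_mod_cast h1

/-- The numbers `e_L(X⁻¹ ∑ u_j ω_j)`, with `u` running through the vectors of constants. -/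
def partialTorsion : (Fin (s + 1) → degreeLT k (X : k[X]).natDegree) →ₗ[k] K :=
  hω.tail.isDiscrete.expMap ∘ₗ torsionRep ω X

theorem partialTorsion_apply (u : Fin (s + 1) → degreeLT k (X : k[X]).natDegree) :
    hω.partialTorsion u = expo (constLattice k (Fin.tail ω)) (torsionRep ω X u) :=
  hω.tail.isDiscrete.expMap_apply _

theorem hasProd_torsionMap (u : Fin (s + 1) → degreeLT k (X : k[X]).natDegree) :
    HasProd (fun a : k[X] => expFactor (hω.partialTorsion u) (expMul ω a)) (hω.torsionMap X u) := by
  rw [partialTorsion_apply, torsionMap_apply]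
  exact hω.hasProd_expo_cons _

omit [Fintype k] hω [IsUltrametricDist K] [CompleteSpace K] [DegreeNorm k K] in
theorem torsionRep_cons (a : k[X]) (c : degreeLT k a.natDegree)
    (v : Fin s → degreeLT k a.natDegree) :
    torsionRep ω a (Fin.cons c v : Fin (s + 1) → degreeLT k a.natDegree) =
      (algebraMap k[X] K a)⁻¹ * (algebraMap k[X] K c * ω 0) + torsionRep (Fin.tail ω) a v := by
  change (algebraMap k[X] K a)⁻¹ * comb ω (fun j => ((Fin.cons c v :
      Fin (s + 1) → degreeLT k a.natDegree) j : k[X])) =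
    _ + (algebraMap k[X] K a)⁻¹ * comb (Fin.tail ω) fun j => (v j : k[X])
  rw [← mul_add, ← comb_cons]
  congr 2
  ext1 j
  refine Fin.cases ?_ (fun i => ?_) j <;> simp

theorem partialTorsion_cons (c : degreeLT k (X : k[X]).natDegree)
    (v : Fin s → degreeLT k (X : k[X]).natDegree) :
    hω.partialTorsion (Fin.cons c v : Fin (s + 1) → degreeLT k (X : k[X]).natDegree) =
      hω.partialTorsion (Fin.cons c 0 : Fin (s + 1) → degreeLT k (X : k[X]).natDegree) +
        hω.tail.torsionMap X v := by
  change hω.tail.isDiscrete.expMap _ = hω.tail.isDiscrete.expMap _ + hω.tail.isDiscrete.expMap _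
  rw [torsionRep_cons, torsionRep_cons, map_zero, add_zero, map_add]

/-- The product over v, with its constant, is φ'_t at e'(aω₁) - e'(t⁻¹cω₁), so the functional
equation applies. -/
theorem mul_prod_sub_partialTorsion (a : k[X]) (c : degreeLT k (X : k[X]).natDegree) :
    (hω.tail.phi X).leadingCoeff * ∏ v : Fin s → degreeLT k (X : k[X]).natDegree,
      (expMul ω a - hω.partialTorsion
        (Fin.cons c v : Fin (s + 1) → degreeLT k (X : k[X]).natDegree)) =
      expMul ω (X * a - (c : k[X])) := by
  classical
  have hinj := hω.tail.torsionMap_injective (X_ne_zero (R := k))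
  have h0 := algebraMap_ne_zero_of_ne K (X_ne_zero (R := k))
  have h2 : ∀ v, expMul ω a - hω.partialTorsion
      (Fin.cons c v : Fin (s + 1) → degreeLT k (X : k[X]).natDegree) =
      expMul ω a - hω.partialTorsion
      (Fin.cons c 0 : Fin (s + 1) → degreeLT k (X : k[X]).natDegree) - hω.tail.torsionMap X v := by
    intro v
    rw [hω.partialTorsion_cons c v, sub_sub]
  rw [Finset.prod_congr rfl fun v _ => h2 v]
  rw [← vanishing_range _ hinj]
  have h1 := eval_subspacePoly (α := algebraMap k[X] K X) hinj (expMul ω a - hω.partialTorsion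
    (Fin.cons c 0 : Fin (s + 1) → degreeLT k (X : k[X]).natDegree))
  change _ = (hω.tail.phi X).leadingCoeff * _ at h1
  rw [← h1, partialTorsion_apply, expMul, ← hω.tail.isDiscrete.expo_sub]
  change eval _ (hω.tail.phi X) = _
  rw [hω.tail.eval_phi_expo X_ne_zero, torsionRep_cons, map_zero, add_zero, mul_sub,
    mul_inv_cancel_left₀ h0, expMul, map_sub, map_mul, sub_mul, mul_assoc]

end

end IsLatticeBasis

end ProductFormula

/-! ### The product formula for the discriminant -/

section ProductFormula

open Filter

theorem prod_fin_succ_fun {s : ℕ} {U M : Type*} [Fintype U] [CommMonoid M]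
    (f : (Fin (s + 1) → U) → M) : ∏ u, f u = ∏ c, ∏ v : Fin s → U, f (Fin.cons c v) := by
  rw [← Fintype.prod_prod_type', ← (Fin.consEquiv fun _ => U).prod_comp]
  rfl

variable {k K : Type*} [Field k] [Fintype k] [NormedField K] [IsUltrametricDist K] [CompleteSpace K]
  [Algebra k[X] K] [Algebra k K] [IsScalarTower k k[X] K] [DegreeNorm k K] {s : ℕ}

omit [Fintype k] in
theorem mem_degreeLT_natDegree_X {c : k[X]} :
    c ∈ degreeLT k (X : k[X]).natDegree ↔ c.natDegree = 0 := by
  rw [mem_degreeLT_natDegree X_ne_zero, degree_X, Nat.WithBot.lt_one_iff_le_zero,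
    natDegree_eq_zero_iff_degree_le_zero]

theorem card_degreeLT_natDegree_X :
    Fintype.card (degreeLT k (X : k[X]).natDegree) = Fintype.card k := by
  rw [card_degreeLT, natDegree_X, pow_one]

-- Division by X with the remainder negated; it reindexes products over all polynomials.
omit [Fintype k] in
theorem bijective_X_mul_sub : Function.Bijective
    fun p : k[X] × degreeLT k (X : k[X]).natDegree => X * p.1 - (p.2 : k[X]) := by
  constructor
  · rintro ⟨a, c⟩ ⟨b, d⟩ h
    have h : X * a - (c : k[X]) = X * b - (d : k[X]) := h
    have h1 : X * (a - b) = (c : k[X]) - (d : k[X]) := by linear_combination h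
    have h2 : (c : k[X]) - (d : k[X]) = 0 := eq_zero_of_dvd_of_degree_lt ⟨_, h1.symm⟩
      ((mem_degreeLT_natDegree X_ne_zero).1 (Submodule.sub_mem _ c.2 d.2))
    rw [h2, mul_eq_zero, or_iff_right X_ne_zero, sub_eq_zero] at h1
    subst h1
    rw [Subtype.ext (sub_eq_zero.1 h2)]
  · intro a
    refine ⟨(a / X, ⟨-(a % X), Submodule.neg_mem _ ((mem_degreeLT_natDegree X_ne_zero).2
      (degree_mod_lt a X_ne_zero))⟩), ?_⟩
    change X * (a / X) - -(a % X) = a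
    rw [sub_neg_eq_add, EuclideanDomain.div_add_mod]

namespace IsLatticeBasis

variable {ω : Fin (s + 1) → K} {η : ℝ} (hω : IsLatticeBasis k ω η)
include hω

/-- There are q^(s+1) vectors u, so this power of e'(aω₁) clears all denominators; each of the q
first entries c then uses one factor Δ'_t. -/
theorem prod_expFactor_partialTorsion [DecidableEq (Fin (s + 1) → degreeLT k (X : k[X]).natDegree)]
    {a : k[X]} (ha : a ≠ 0) :
    (hω.tail.phi X).leadingCoeff ^ Fintype.card k *
      (∏ u : {u : Fin (s + 1) → degreeLT k (X : k[X]).natDegree // u ≠ 0},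
        expFactor (hω.partialTorsion u) (expMul ω a)) * expMul ω a ^ Fintype.card k ^ (s + 1) =
      ∏ c : degreeLT k (X : k[X]).natDegree, expMul ω (X * a - (c : k[X])) := by
  have hm : expMul ω a ≠ 0 := fun h => ha (hω.expMul_eq_zero_iff.1 h)
  have h1 : ∏ u : {u : Fin (s + 1) → degreeLT k (X : k[X]).natDegree // u ≠ 0},
      expFactor (hω.partialTorsion u) (expMul ω a) =
      ∏ u, (1 - hω.partialTorsion u / expMul ω a) := by
    rw [prod_eq_mul_prod_ne_zero fun u => 1 - hω.partialTorsion u / expMul ω a, map_zero, zero_div,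
      sub_zero, one_mul]
    exact Finset.prod_congr rfl fun u _ => expFactor_of_ne hm
  have h2 : Fintype.card k ^ (s + 1) =
      (Finset.univ : Finset (Fin (s + 1) → degreeLT k (X : k[X]).natDegree)).card := by
    rw [Finset.card_univ, card_fun_degreeLT, natDegree_X, mul_one]
  rw [h1, mul_assoc, h2, ← Finset.prod_const, ← Finset.prod_mul_distrib,
    ← card_degreeLT_natDegree_X, ← Finset.card_univ, ← Finset.prod_const, prod_fin_succ_fun,
    ← Finset.prod_mul_distrib]
  refine Finset.prod_congr rfl fun c _ => ?_
  rw [← hω.mul_prod_sub_partialTorsion]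
  congr 1
  refine Finset.prod_congr rfl fun v _ => ?_
  field_simp

/-- Constants come out of e' by linearity, and Wilson's theorem gives the sign. -/
theorem prod_expMul_constant [DecidableEq (degreeLT k (X : k[X]).natDegree)] :
    ∏ c : {c : degreeLT k (X : k[X]).natDegree // c ≠ 0}, expMul ω (c.1 : k[X]) =
      -expMul ω (1 : k[X]) ^ (Fintype.card k - 1) := by
  classical
  let f : kˣ → {c : degreeLT k (X : k[X]).natDegree // c ≠ 0} := fun x =>
    ⟨⟨C (x : k), mem_degreeLT_natDegree_X.2 (natDegree_C _)⟩, fun h =>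
      x.ne_zero (C_eq_zero.1 (congrArg Subtype.val h))⟩
  have hf : Function.Bijective f := by
    constructor
    · intro x y h
      have h : C (x : k) = C (y : k) := congrArg (fun z => (z.1 : k[X])) h
      exact Units.ext (C_injective h)
    · rintro ⟨⟨c, hc⟩, hc0⟩
      obtain ⟨x, rfl⟩ := natDegree_eq_zero.1 (mem_degreeLT_natDegree_X.1 hc)
      have hx : x ≠ 0 := by
        rintro rfl
        exact hc0 (Subtype.ext (by simp))
      exact ⟨Units.mk0 x hx, rfl⟩
  have h1 : ∀ x : kˣ, algebraMap k K x * expMul ω (1 : k[X]) =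
      expMul ω ((f x).1 : k[X]) := by
    intro x
    rw [← hω.expMul_C_mul, mul_one]
  rw [← Fintype.prod_bijective f hf _ _ h1, Finset.prod_mul_distrib, Finset.prod_const,
    Finset.card_univ, Fintype.card_units, ← map_prod]
  have h2 : ∏ x : kˣ, (x : k) = -1 := by
    have := congrArg Units.val (FiniteField.prod_univ_units_id_eq_neg_one (K := k))
    simpa using this
  rw [h2, map_neg, map_one, neg_one_mul]

/-- The vectors with first entry 0 give the nonzero t-torsion of rank s, hence t; those with first
entry c ≠ 0 give e'(cω₁). -/
theorem prod_partialTorsion [DecidableEq (Fin (s + 1) → degreeLT k (X : k[X]).natDegree)] :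
    (hω.tail.phi X).leadingCoeff ^ Fintype.card k *
      (∏ u : {u : Fin (s + 1) → degreeLT k (X : k[X]).natDegree // u ≠ 0}, hω.partialTorsion u) =
      -algebraMap k[X] K X * expMul ω (1 : k[X]) ^ (Fintype.card k - 1) := by
  classical
  have h1 : ∏ u : {u : Fin (s + 1) → degreeLT k (X : k[X]).natDegree // u ≠ 0},
      hω.partialTorsion u = ∏ u, if u = 0 then 1 else hω.partialTorsion u := by
    rw [prod_eq_mul_prod_ne_zero fun u => if u = 0 then 1 else hω.partialTorsion u, if_pos rfl,
      one_mul]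
    exact Finset.prod_congr rfl fun u _ => (if_neg u.2).symm
  rw [h1, neg_mul_comm, ← hω.prod_expMul_constant, ← card_degreeLT_natDegree_X,
    ← Finset.card_univ, ← Finset.prod_const, prod_fin_succ_fun, ← Finset.prod_mul_distrib,
    prod_eq_mul_prod_ne_zero]
  have hcons : ∀ v : Fin s → degreeLT k (X : k[X]).natDegree,
      (Fin.cons 0 v : Fin (s + 1) → degreeLT k (X : k[X]).natDegree) = 0 ↔ v = 0 := by
    intro v
    refine ⟨fun h => funext fun i => by simpa using congrFun h i.succ, ?_⟩
    rintro rfl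
    ext1 j
    refine Fin.cases ?_ (fun i => ?_) j <;> simp
  congr 1
  · rw [prod_eq_mul_prod_ne_zero, if_pos ((hcons 0).2 rfl), one_mul,
      ← leadingCoeff_subspacePoly_mul_prod (hω.tail.torsionMap_injective (X_ne_zero (R := k)))
        (α := algebraMap k[X] K X)]
    congr 1
    refine Finset.prod_congr rfl fun v _ => ?_
    rw [if_neg fun h => v.2 ((hcons v).1 h), hω.partialTorsion_cons]
    have : (Fin.cons 0 0 : Fin (s + 1) → degreeLT k (X : k[X]).natDegree) = 0 := (hcons 0).2 rfl
    rw [this, map_zero, zero_add]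
  · refine Finset.prod_congr rfl fun c _ => ?_
    -- The point a = 0 produces factors with a minus sign; replacing (c, v) by its negative removes
    -- it.
    have h2 := hω.mul_prod_sub_partialTorsion 0 (-c)
    rw [hω.expMul_eq_zero_iff.2 rfl, mul_zero, zero_sub, Submodule.coe_neg, neg_neg] at h2
    rw [← h2]
    congr 1
    refine Fintype.prod_equiv (Equiv.neg _) _ _ fun v => ?_
    have h3 : (Fin.cons (-c : degreeLT k (X : k[X]).natDegree) (-v) :
        Fin (s + 1) → degreeLT k (X : k[X]).natDegree) = -Fin.cons c v := by
      ext1 j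
      refine Fin.cases ?_ (fun i => ?_) j <;> simp
    rw [if_neg, Equiv.neg_apply, h3, map_neg, zero_sub, neg_neg]
    intro h
    exact c.2 (congrFun h 0)

theorem expMul_one_ne_zero : expMul ω (1 : k[X]) ≠ 0 :=
  fun h => one_ne_zero (hω.expMul_eq_zero_iff.1 h)

theorem expMul_eq_unitFactor {a : k[X]} (ha : a ≠ 0) :
    expMul ω a = (hω.tail.phi a).leadingCoeff *
      expMul ω (1 : k[X]) ^ (Fintype.card k ^ (s * a.natDegree)) *
      hω.tail.unitFactor (expMul ω (1 : k[X]))⁻¹ a := by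
  rw [← hω.tail.eval_phi_eq_unitFactor ha hω.expMul_one_ne_zero, hω.eval_phi_expMul ha, mul_one]

/-- Needed for the fibre of a = 0 under (a, c) ↦ Xa - c, which consists of constants. -/
theorem unitFactor_of_natDegree_eq_zero {a : k[X]} (ha : a ≠ 0) (h : a.natDegree = 0) :
    hω.tail.unitFactor (expMul ω (1 : k[X]))⁻¹ a = 1 := by
  have h1 := hω.expMul_eq_unitFactor ha
  have h2 := algebraMap_ne_zero_of_ne K ha
  rw [hω.tail.leadingCoeff_phi_of_natDegree_eq_zero ha h, h, mul_zero, pow_zero, pow_one] at h1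
  have h3 : expMul ω a = algebraMap k[X] K a * expMul ω (1 : k[X]) := by
    obtain ⟨c, rfl⟩ := natDegree_eq_zero.1 h
    have := hω.expMul_C_mul c 1
    rwa [mul_one, IsScalarTower.algebraMap_apply k k[X] K, Polynomial.algebraMap_eq] at this
  rw [h3] at h1
  exact (mul_eq_left₀ (mul_ne_zero h2 hω.expMul_one_ne_zero)).1 h1.symm

theorem unitFactor_ne_zero {a : k[X]} (ha : a ≠ 0) :
    hω.tail.unitFactor (expMul ω (1 : k[X]))⁻¹ a ≠ 0 := by
  intro h
  have h1 := hω.expMul_eq_unitFactor ha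
  rw [h, mul_zero, hω.expMul_eq_zero_iff] at h1
  exact ha h1

/-- With e'(aω₁) = h g_a, the degree and leading coefficient of φ'_{Xa-c} give e'((Xa - c)ω₁) = δ
h^(q^s) g_{Xa-c}. Both sides then carry the same factor δ^q h^(q^(s+1)), which cancels. -/
theorem prod_expFactor_mul_unitFactor_pow (hs : 0 < s)
    [DecidableEq (Fin (s + 1) → degreeLT k (X : k[X]).natDegree)] {a : k[X]} (ha : a ≠ 0) :
    (∏ u : {u : Fin (s + 1) → degreeLT k (X : k[X]).natDegree // u ≠ 0},
        expFactor (hω.partialTorsion u) (expMul ω a)) *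
      hω.tail.unitFactor (expMul ω (1 : k[X]))⁻¹ a ^ Fintype.card k ^ (s + 1) =
      ∏ c : degreeLT k (X : k[X]).natDegree,
        hω.tail.unitFactor (expMul ω (1 : k[X]))⁻¹ (X * a - (c : k[X])) := by
  have h1 := hω.prod_expFactor_partialTorsion ha
  generalize (∏ u : {u : Fin (s + 1) → degreeLT k (X : k[X]).natDegree // u ≠ 0},
    expFactor (hω.partialTorsion u) (expMul ω a)) = P at h1 ⊢
  set m := expMul ω (1 : k[X]) with hm
  set δ := (hω.tail.phi X).leadingCoeff with hδ
  set h := (hω.tail.phi a).leadingCoeff * m ^ (Fintype.card k ^ (s * a.natDegree)) with hh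
  have hδ0 : δ ≠ 0 := hω.tail.leadingCoeff_phi_ne_zero X_ne_zero
  have hm0 : m ≠ 0 := hω.expMul_one_ne_zero
  have hh0 : h ≠ 0 := mul_ne_zero (hω.tail.leadingCoeff_phi_ne_zero ha) (pow_ne_zero _ hm0)
  have h2 : ∀ c : k[X], c.natDegree = 0 → expMul ω (X * a - c) =
      δ * h ^ (Fintype.card k ^ s) * hω.tail.unitFactor m⁻¹ (X * a - c) := by
    intro c hc
    have hdeg : (X * a - c).natDegree = a.natDegree + 1 := by
      rw [natDegree_sub_eq_left_of_natDegree_lt, natDegree_X_mul ha]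
      rw [hc, natDegree_X_mul ha]
      omega
    have hne : X * a - c ≠ 0 := by
      intro h0
      rw [h0, natDegree_zero] at hdeg
      omega
    rw [hω.expMul_eq_unitFactor hne, hdeg, hω.leadingCoeff_phi_mul_sub hs X_ne_zero ha
      (by rw [natDegree_X]; exact one_pos) hc hne, natDegree_X, hh, mul_pow, ← pow_mul, ← pow_add,
      ← hm, ← hδ]
    ring_nf
  clear_value h
  have h4 : ∀ c : degreeLT k (X : k[X]).natDegree, _ :=
    fun c => h2 c (mem_degreeLT_natDegree_X.1 c.2)
  rw [Finset.prod_congr rfl fun c _ => h4 c, Finset.prod_mul_distrib, Finset.prod_const,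
    Finset.card_univ, card_degreeLT_natDegree_X, hω.expMul_eq_unitFactor ha, ← hm, ← hh, mul_pow,
    mul_pow, ← pow_mul, ← pow_succ] at h1
  have h3 : δ ^ Fintype.card k * h ^ Fintype.card k ^ (s + 1) ≠ 0 :=
    mul_ne_zero (pow_ne_zero _ hδ0) (pow_ne_zero _ hh0)
  apply mul_left_cancel₀ h3
  linear_combination h1

theorem leadingCoeff_phi_eq (hs : 0 < s)
    (hg : Tendsto (fun a : {a : k[X] // a ≠ 0} =>
      hω.tail.unitFactor (expMul ω (1 : k[X]))⁻¹ a) cofinite (𝓝 1)) :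
    (hω.phi X).leadingCoeff = -(hω.tail.phi X).leadingCoeff ^ Fintype.card k *
      (expMul ω (1 : k[X]))⁻¹ ^ (Fintype.card k - 1) *
      ∏' a : {a : k[X] // a ≠ 0}, hω.tail.unitFactor (expMul ω (1 : k[X]))⁻¹ a ^
        (Fintype.card k ^ (s + 1) - 1) := by
  classical
  set g : {a : k[X] // a ≠ 0} → K := fun a =>
    hω.tail.unitFactor (expMul ω (1 : k[X]))⁻¹ a with hgdef
  have hG := (multipliable_of_tendsto_one hg).hasProd
  have hG0 := ne_zero_of_hasProd hg (fun a => hω.unitFactor_ne_zero a.2) hG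
  set G := ∏' a, g a
  -- The value 1 at zero permits reindexing over all of k[X] without changing the product.
  set g' : k[X] → K := fun a =>
    if a = 0 then 1 else hω.tail.unitFactor (expMul ω (1 : k[X]))⁻¹ a with hg'
  have hg'ne : ∀ a, a ≠ 0 → g' a = hω.tail.unitFactor (expMul ω (1 : k[X]))⁻¹ a :=
    fun a ha => if_neg ha
  have hG' : HasProd g' G := by
    rw [← hasProd_subtype_iff_of_mulSupport_subset (s := {a : k[X] | a ≠ 0})]
    · exact hG.congr_fun fun a => hg'ne a a.2
    · intro a ha h0
      exact ha (if_pos h0)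
  have hA := hasProd_prod (s := Finset.univ)
    (f := fun (u : {u : Fin (s + 1) → degreeLT k (X : k[X]).natDegree // u ≠ 0}) (a : k[X]) =>
      expFactor (hω.partialTorsion u) (expMul ω a)) fun u _ => hω.hasProd_torsionMap u
  have hAB := hA.mul (hG'.pow (Fintype.card k ^ (s + 1)))
  have hC := HasProd.prod_fiberwise
    ((Equiv.hasProd_iff (Equiv.ofBijective _ (bijective_X_mul_sub (k := k)))).2 hG')
    fun a => hasProd_fintype _
  -- At a = 0 the factor of each u is `hω.partialTorsion u` itself, which puts their product P in
  -- front.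
  have hD := (hasProd_ite_eq (0 : k[X])
    (∏ u : {u : Fin (s + 1) → degreeLT k (X : k[X]).natDegree // u ≠ 0},
      hω.partialTorsion u)).mul hC
  -- This is T G^(q^(s+1)) = P G.
  have key := hAB.unique (hD.congr_fun fun a => ?_)
  · set P := ∏ u : {u : Fin (s + 1) → degreeLT k (X : k[X]).natDegree // u ≠ 0},
      hω.partialTorsion u with hP
    set T := ∏ u : {u : Fin (s + 1) → degreeLT k (X : k[X]).natDegree // u ≠ 0},
      hω.torsionMap X u with hT
    have h1 : (hω.phi X).leadingCoeff * T = algebraMap k[X] K X :=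
      leadingCoeff_subspacePoly_mul_prod (hω.torsionMap_injective (X_ne_zero (R := k)))
    have h2 := hω.prod_partialTorsion
    have hX := algebraMap_ne_zero_of_ne K (X_ne_zero (R := k))
    have hm0 := hω.expMul_one_ne_zero
    rw [(hG.pow _).tprod_eq]
    obtain ⟨n, hn⟩ : ∃ n, Fintype.card k ^ (s + 1) = n + 1 :=
      ⟨_, (Nat.succ_pred_eq_of_pos (pow_pos Fintype.card_pos _)).symm⟩
    rw [hn, pow_succ, ← mul_assoc] at key
    have key := mul_right_cancel₀ hG0 key
    have hT0 : T ≠ 0 := fun h => hX (by rw [← h1, h, mul_zero])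
    rw [hn, Nat.add_sub_cancel]
    apply mul_right_cancel₀ hT0
    rw [h1, inv_pow]
    have hm1 := pow_ne_zero (Fintype.card k - 1) hm0
    field_simp
    rw [← hP] at h2
    linear_combination (hω.tail.phi X).leadingCoeff ^ Fintype.card k * key + h2
  · by_cases ha : a = 0
    · subst ha
      have hone : ∀ c : degreeLT k (X : k[X]).natDegree, g' (X * 0 - (c : k[X])) = 1 := by
        intro c
        by_cases h : X * 0 - (c : k[X]) = 0
        · exact if_pos h
        · rw [hg'ne _ h]
          refine hω.unitFactor_of_natDegree_eq_zero h ?_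
          rw [mul_zero, zero_sub, natDegree_neg]
          exact mem_degreeLT_natDegree_X.1 c.2
      rw [if_pos rfl, show g' 0 = 1 from if_pos rfl, one_pow, mul_one]
      refine Eq.trans ?_ (congrArg _ (Finset.prod_eq_one fun c _ => hone c).symm)
      rw [mul_one]
      refine Finset.prod_congr rfl fun u _ => ?_
      rw [hω.expMul_eq_zero_iff.2 rfl, expFactor_zero]
    · rw [if_neg ha, one_mul, hg'ne a ha, hω.prod_expFactor_mul_unitFactor_pow hs ha]
      refine Finset.prod_congr rfl fun c _ => (hg'ne _ fun h => ha ?_).symm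
      have := bijective_X_mul_sub.1 (a₁ := (a, c)) (a₂ := (0, 0)) (by simpa using h)
      exact congrArg Prod.fst this

end IsLatticeBasis

end ProductFormula

/-! ### Period domains -/

section PeriodDomain

open Filter

variable {Fq : Type*} [Field Fq] [Fintype Fq]

instance CInf.instAlgebraConstants : Algebra Fq (CInf Fq) :=
  ((algebraMap Fq[X] (CInf Fq)).comp C).toAlgebra

instance CInf.instIsScalarTower : IsScalarTower Fq Fq[X] (CInf Fq) :=
  IsScalarTower.of_algebraMap_eq' rfl

instance CInf.instDegreeNorm : DegreeNorm Fq (CInf Fq) := ⟨CInf.norm_algebraMap_polynomial Fq⟩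

theorem latticeExp_eq {s : ℕ} (ω : Fin s → CInf Fq) (x : CInf Fq) :
    latticeExp (lattice ω) x = expo (constLattice Fq ω) x := rfl

theorem drinfeldPoly_eq {s : ℕ} {ω : Fin s → CInf Fq} {η : ℝ} (hω : IsLatticeBasis Fq ω η)
    {a : Fq[X]} (ha : a ≠ 0) : drinfeldPoly (lattice ω) a = hω.phi a :=
  hω.quotientPoly_eq ha

theorem discriminant_eq {s : ℕ} {ω : Fin s → CInf Fq} {η : ℝ} (hω : IsLatticeBasis Fq ω η) :
    discriminant ω = (hω.phi X).leadingCoeff := by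
  rw [discriminant, discriminantAt, drinfeldPoly_eq hω X_ne_zero]

theorem one_add_eval_fPoly {s : ℕ} {ω : Fin s → CInf Fq} {η : ℝ} (hω : IsLatticeBasis Fq ω η)
    {a : Fq[X]} (ha : a ≠ 0) (u : CInf Fq) :
    1 + (fPoly ω a).eval u = hω.unitFactor u a := by
  rw [fPoly, discriminantAt, drinfeldPoly_eq hω ha, eval_sub, eval_one, add_sub_cancel]
  rfl

theorem isLatticeBasis_of_le {s : ℕ} {ω : Fin s → CInf Fq} {η : ℝ} (hη : 0 < η)
    (h : ∀ b : Fin s → FInf Fq, η * ‖b‖ ≤ ‖∑ j, b j • ω j‖) : IsLatticeBasis Fq ω η where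
  pos := hη
  le_norm b j := by
    let ι : Fq[X] → FInf Fq := fun a =>
      algebraMap (RatFunc Fq) (FInf Fq) (algebraMap Fq[X] (RatFunc Fq) a)
    have h1 : ∀ a, algebraMap Fq[X] (CInf Fq) a = algebraMap (FInf Fq) (CInf Fq) (ι a) :=
      fun _ => rfl
    have h2 : comb ω b = ∑ j, ι (b j) • ω j := by
      rw [comb_apply]
      refine Finset.sum_congr rfl fun i _ => ?_
      rw [Algebra.smul_def, Algebra.smul_def, h1]
    rw [h2, h1, norm_algebraMap']
    refine le_trans ?_ (h fun j => ι (b j))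
    gcongr
    exact norm_le_pi_norm (fun j => ι (b j)) j

/-- An injective linear map from a finite-dimensional space over the complete field F_∞ is bounded
below. -/
theorem exists_isLatticeBasis {ξ : CInf Fq} {s : ℕ} {ω : Fin s → CInf Fq}
    (hω : ω ∈ periodDomain ξ s) : ∃ η, IsLatticeBasis Fq ω η := by
  let f : (Fin s → FInf Fq) →ₗ[FInf Fq] CInf Fq := Fintype.linearCombination (FInf Fq) ω
  have hf : f.ker = ⊥ := by
    rw [LinearMap.ker_eq_bot']
    intro h h0
    by_contra hne
    exact hω.2 h hne h0
  obtain ⟨B, hB, hanti⟩ := f.exists_antilipschitzWith hf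
  have hB' : (0 : ℝ) < B := hB
  refine ⟨(B : ℝ)⁻¹, isLatticeBasis_of_le (inv_pos.2 hB') fun b => ?_⟩
  have h := hanti.le_mul_dist b 0
  rw [map_zero, dist_zero_right, dist_zero_right] at h
  rw [inv_mul_le_iff₀ hB']
  exact h

theorem bddBelow_hyperplane {s : ℕ} (ω : Fin s → CInf Fq) :
    BddBelow (Set.range fun h : {h : Fin s → FInf Fq // ‖h‖ = 1} => ‖∑ j, h.1 j • ω j‖) :=
  ⟨0, by rintro _ ⟨h, rfl⟩; exact norm_nonneg _⟩

/-- The norm of b is attained by an entry, so b can be rescaled to norm 1 within F_∞. -/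
theorem hyperplaneDist_mul_norm_le {s : ℕ} (ω : Fin s → CInf Fq) (b : Fin s → FInf Fq) :
    hyperplaneDist ω * ‖b‖ ≤ ‖∑ j, b j • ω j‖ := by
  rcases eq_or_ne b 0 with rfl | hb
  · simp
  obtain ⟨i, hi⟩ := Function.ne_iff.1 hb
  have : Nonempty (Fin s) := ⟨i⟩
  obtain ⟨j, hj⟩ := Finite.exists_max fun j => ‖b j‖
  have hnorm : ‖b‖ = ‖b j‖ :=
    le_antisymm ((pi_norm_le_iff_of_nonneg (norm_nonneg _)).2 hj) (norm_le_pi_norm b j)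
  have hpos : 0 < ‖b j‖ := (norm_pos_iff.2 hi).trans_le (hj i)
  have h1 : ‖(b j)⁻¹ • b‖ = 1 := by
    rw [norm_smul, norm_inv, hnorm, inv_mul_cancel₀ hpos.ne']
  have h2 := ciInf_le (bddBelow_hyperplane ω) ⟨(b j)⁻¹ • b, h1⟩
  have h3 : ∑ i, ((b j)⁻¹ • b) i • ω i = (b j)⁻¹ • ∑ i, b i • ω i := by
    rw [Finset.smul_sum]
    refine Finset.sum_congr rfl fun i _ => ?_
    rw [Pi.smul_apply, smul_eq_mul, mul_smul]
  have h4 : hyperplaneDist ω ≤ ‖b j‖⁻¹ * ‖∑ i, b i • ω i‖ := by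
    rw [← norm_inv, ← norm_smul, ← h3]
    exact h2
  rw [hnorm, mul_comm]
  rwa [le_inv_mul_iff₀ hpos] at h4

theorem hyperplaneDist_le_norm {s : ℕ} (ω : Fin s → CInf Fq) (j : Fin s) :
    hyperplaneDist ω ≤ ‖ω j‖ := by
  classical
  have h1 : ‖(Pi.single j 1 : Fin s → FInf Fq)‖ = 1 := by
    rw [Pi.norm_single, norm_one]
  refine (ciInf_le (bddBelow_hyperplane ω) ⟨Pi.single j 1, h1⟩).trans_eq ?_
  congr 1
  rw [Finset.sum_eq_single j]
  · simp
  · intro i _ hij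
    simp [hij]
  · simp

variable {ξ : CInf Fq} {s n : ℕ} {ω : Fin s → CInf Fq}

/-- The normalisation ω_s = ξ turns the scale-invariant condition into a bound: |ω| ≤ q^n |ω|_i ≤
q^n |ω_s|. -/
theorem norm_le_of_mem_periodDomainLevel (hs : 0 < s) (hω : ω ∈ periodDomainLevel ξ s n) :
    ‖ω‖ ≤ (Fintype.card Fq : ℝ) ^ n * ‖ξ‖ := by
  have hq : (0 : ℝ) < Fintype.card Fq := by exact_mod_cast Fintype.card_pos
  have h1 := hω.2.trans (hyperplaneDist_le_norm ω ⟨s - 1, by omega⟩)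
  rw [hω.1.1 ⟨s - 1, by omega⟩ (by simp only; omega)] at h1
  rwa [inv_mul_le_iff₀ (by positivity)] at h1

theorem isLatticeBasis_of_mem_periodDomainLevel (hξ : ξ ≠ 0) (hs : 0 < s)
    (hω : ω ∈ periodDomainLevel ξ s n) : IsLatticeBasis Fq ω (hyperplaneDist ω) := by
  have hq : (0 : ℝ) < Fintype.card Fq := by exact_mod_cast Fintype.card_pos
  refine isLatticeBasis_of_le ?_ (hyperplaneDist_mul_norm_le ω)
  have h1 := norm_le_pi_norm ω ⟨s - 1, by omega⟩
  rw [hω.1.1 ⟨s - 1, by omega⟩ (by simp only; omega)] at h1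
  have h2 : 0 < ‖ω‖ := (norm_pos_iff.2 hξ).trans_le h1
  exact lt_of_lt_of_le (by positivity) hω.2

/-- The radius of convergence of the product expansion of the discriminant. -/
def expansionRadius (ξ : CInf Fq) (s n : ℕ) : ℝ :=
  (2 * ((Fintype.card Fq : ℝ) ^ n * ‖ξ‖ *
    ((Fintype.card Fq : ℝ) ^ n) ^ Fintype.card Fq ^ (s * n)))⁻¹

theorem expansionRadius_pos (hξ : ξ ≠ 0) : 0 < expansionRadius ξ s n := by
  have hq : (0 : ℝ) < Fintype.card Fq := by exact_mod_cast Fintype.card_pos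
  have := norm_pos_iff.2 hξ
  rw [expansionRadius]
  positivity

/-- The torsion bound applies with R = |ω| ≤ q^n |ξ| and D = n, since |ω| / |ω|_i ≤ q^n. The factor
2 in `expansionRadius` makes its product with |u| at most 1/2. -/
theorem norm_eval_fPoly_sq_le (hξ : ξ ≠ 0) (hs : 0 < s) (hω : ω ∈ periodDomainLevel ξ s n)
    {u : CInf Fq} (hu : ‖u‖ < expansionRadius ξ s n) {a : Fq[X]} (ha : a ≠ 0) :
    ‖1 + (fPoly ω a).eval u - 1‖ ^ 2 ≤ (1 / 2 : ℝ) ^ (Fintype.card Fq ^ (s * a.natDegree)) := by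
  have hq : (0 : ℝ) < Fintype.card Fq := by exact_mod_cast Fintype.card_pos
  have hb := isLatticeBasis_of_mem_periodDomainLevel hξ hs hω
  rw [one_add_eval_fPoly hb ha]
  have hξ0 := norm_pos_iff.2 hξ
  have hD : ‖ω‖ / hyperplaneDist ω ≤ (Fintype.card Fq : ℝ) ^ n := by
    have := hω.2
    rw [inv_mul_le_iff₀ (by positivity)] at this
    rwa [div_le_iff₀ hb.pos]
  have hM : ‖ω‖ * ((Fintype.card Fq : ℝ) ^ n) ^ Fintype.card Fq ^ (s * n) * ‖u‖ ≤ 1 / 2 := by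
    have h1 := norm_le_of_mem_periodDomainLevel hs hω
    have hu0 : ‖u‖ * (2 * ((Fintype.card Fq : ℝ) ^ n * ‖ξ‖ *
        ((Fintype.card Fq : ℝ) ^ n) ^ Fintype.card Fq ^ (s * n))) < 1 := by
      rwa [expansionRadius, ← one_div, lt_div_iff₀ (by positivity)] at hu
    refine le_trans (b := (Fintype.card Fq : ℝ) ^ n * ‖ξ‖ *
      ((Fintype.card Fq : ℝ) ^ n) ^ Fintype.card Fq ^ (s * n) * ‖u‖) (by gcongr) ?_
    linarith
  refine (hb.norm_unitFactor_sub_one_sq_le (norm_le_pi_norm ω) (norm_nonneg _) hD ha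
    (hM.trans (by norm_num))).trans ?_
  gcongr

theorem norm_eval_fPoly_le_one (hξ : ξ ≠ 0) (hs : 0 < s) (hω : ω ∈ periodDomainLevel ξ s n)
    {u : CInf Fq} (hu : ‖u‖ < expansionRadius ξ s n) {a : Fq[X]} (ha : a ≠ 0) :
    ‖1 + (fPoly ω a).eval u - 1‖ ≤ 1 := by
  have h := (norm_eval_fPoly_sq_le hξ hs hω hu ha).trans
    (pow_le_one₀ (by norm_num) (by norm_num))
  exact (sq_le_one_iff₀ (norm_nonneg _)).1 h

theorem eventually_norm_eval_fPoly_le (hξ : ξ ≠ 0) (hs : 0 < s) {ε : ℝ} (hε : 0 < ε) :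
    ∀ᶠ a : {a : Fq[X] // a ≠ 0} in cofinite, ∀ u : CInf Fq, ‖u‖ < expansionRadius ξ s n →
      ∀ ω ∈ periodDomainLevel ξ s n, ‖1 + (fPoly ω a.1).eval u - 1‖ ≤ ε := by
  obtain ⟨d, hd⟩ := exists_pow_lt_of_lt_one (show 0 < ε ^ 2 by positivity)
    (show (1 / 2 : ℝ) < 1 by norm_num)
  have hfin : {a : {a : Fq[X] // a ≠ 0} | a.1.natDegree < d}.Finite :=
    (finite_natDegree_lt d).preimage Subtype.val_injective.injOn
  rw [Filter.eventually_cofinite]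
  refine hfin.subset fun a ha => ?_
  by_contra hda
  apply ha
  intro u hu ω hω
  have hda : d ≤ a.1.natDegree := not_lt.1 hda
  -- Positivity of s makes the exponents grow with deg a.
  have h1 : d ≤ Fintype.card Fq ^ (s * a.1.natDegree) :=
    hda.trans ((Nat.le_mul_of_pos_left _ hs).trans (Nat.lt_pow_self Fintype.one_lt_card).le)
  have h2 := (norm_eval_fPoly_sq_le hξ hs hω hu a.2).trans
    ((pow_le_pow_of_le_one (by norm_num) (by norm_num) h1).trans hd.le)
  exact (sq_le_sq₀ (norm_nonneg _) hε.le).1 h2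

theorem tendsto_one_add_eval_fPoly (hξ : ξ ≠ 0) (hs : 0 < s) (hω : ω ∈ periodDomainLevel ξ s n)
    {u : CInf Fq} (hu : ‖u‖ < expansionRadius ξ s n) :
    Tendsto (fun a : {a : Fq[X] // a ≠ 0} => 1 + (fPoly ω a.1).eval u) cofinite (𝓝 1) := by
  rw [Metric.tendsto_nhds]
  intro ε hε
  filter_upwards [eventually_norm_eval_fPoly_le (n := n) hξ hs (half_pos hε)] with a ha
  rw [dist_eq_norm]
  exact (ha u hu ω hω).trans_lt (half_lt_self hε)

theorem multipliableUniformlyOn_fPoly_pow (hξ : ξ ≠ 0) (hs : 0 < s) (m : ℕ) :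
    MultipliableUniformlyOn
      (fun (a : {a : Fq[X] // a ≠ 0}) (p : CInf Fq × (Fin s → CInf Fq)) =>
        (1 + (fPoly p.2 a.1).eval p.1) ^ m)
      (Metric.ball (0 : CInf Fq) (expansionRadius ξ s n) ×ˢ periodDomainLevel ξ s n) := by
  apply multipliableUniformlyOn_of_norm_sub_one_le
  · rintro a ⟨u, ω⟩ ⟨hu, hω⟩
    exact norm_pow_sub_one_le zero_le_one le_rfl
      (norm_eval_fPoly_le_one hξ hs hω (mem_ball_zero_iff.1 hu) a.2) m
  · intro ε hε
    filter_upwards [eventually_norm_eval_fPoly_le (ξ := ξ) (n := n) hξ hs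
      (lt_min one_pos hε)] with a ha
    rintro ⟨u, ω⟩ ⟨hu, hω⟩
    exact (norm_pow_sub_one_le (lt_min one_pos hε).le (min_le_left _ _)
      (ha u (mem_ball_zero_iff.1 hu) ω hω) m).trans (min_le_right _ _)

theorem discriminant_eq_prod (hξ : ξ ≠ 0) (hs : 0 < s) {ω : Fin (s + 1) → CInf Fq}
    (hω : ω ∈ periodDomain ξ (s + 1)) (hω' : Fin.tail ω ∈ periodDomainLevel ξ s n)
    (hu : ‖(latticeExp (lattice (Fin.tail ω)) (ω 0))⁻¹‖ < expansionRadius ξ s n) :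
    discriminant ω = -discriminant (Fin.tail ω) ^ Fintype.card Fq *
      (latticeExp (lattice (Fin.tail ω)) (ω 0))⁻¹ ^ (Fintype.card Fq - 1) *
      ∏' a : {a : Fq[X] // a ≠ 0},
        (1 + (fPoly (Fin.tail ω) a.1).eval (latticeExp (lattice (Fin.tail ω)) (ω 0))⁻¹) ^
          (Fintype.card Fq ^ (s + 1) - 1) := by
  -- Any η suffices for the full vector; explicit constants are only needed for its tail, where the
  -- product must converge.
  obtain ⟨η, hη⟩ := exists_isLatticeBasis hω
  have h1 : latticeExp (lattice (Fin.tail ω)) (ω 0) = expMul ω (1 : Fq[X]) := by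
    rw [latticeExp_eq, expMul, map_one, one_mul]
  have htend := tendsto_one_add_eval_fPoly hξ hs hω' hu
  rw [h1] at htend ⊢
  have h2 : ∀ a : {a : Fq[X] // a ≠ 0},
      1 + (fPoly (Fin.tail ω) a.1).eval (expMul ω (1 : Fq[X]))⁻¹ =
        hη.tail.unitFactor (expMul ω (1 : Fq[X]))⁻¹ a.1 :=
    fun a => one_add_eval_fPoly hη.tail a.2 _
  simp only [h2] at htend ⊢
  rw [discriminant_eq hη, discriminant_eq hη.tail]
  exact hη.leadingCoeff_phi_eq hs htend

end PeriodDomain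

end DrinfeldDiscriminant

end

theorem theorem3p2 (Fq : Type*) [Field Fq] [Fintype Fq] (ξ : CInf Fq) (hξ : ξ ≠ 0)
    (r : ℕ) (hr : 2 ≤ r) (n : ℕ) :
    ∃ ρ : ℝ, 0 < ρ ∧
      MultipliableUniformlyOn
        (fun (a : {a : Fq[X] // a ≠ 0}) (p : CInf Fq × (Fin (r - 1) → CInf Fq)) =>
          1 + (fPoly p.2 a.1).eval p.1)
        (Metric.ball (0 : CInf Fq) ρ ×ˢ periodDomainLevel ξ (r - 1) n) ∧
      MultipliableUniformlyOn
        (fun (a : {a : Fq[X] // a ≠ 0}) (p : CInf Fq × (Fin (r - 1) → CInf Fq)) =>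
          (1 + (fPoly p.2 a.1).eval p.1) ^ (Fintype.card Fq ^ r - 1))
        (Metric.ball (0 : CInf Fq) ρ ×ˢ periodDomainLevel ξ (r - 1) n) ∧
      ∀ ω ∈ periodDomain ξ r, dropFirst ω ∈ periodDomainLevel ξ (r - 1) n → ‖uParam hr ω‖ < ρ →
        discriminant ω =
          -discriminant (dropFirst ω) ^ Fintype.card Fq * uParam hr ω ^ (Fintype.card Fq - 1) *
            ∏' a : {a : Fq[X] // a ≠ 0},
              (1 + (fPoly (dropFirst ω) a.1).eval (uParam hr ω)) ^ (Fintype.card Fq ^ r - 1) := by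
  obtain ⟨s, rfl⟩ : ∃ s, r = s + 1 := ⟨r - 1, by omega⟩
  have hs : 0 < s := by omega
  refine ⟨expansionRadius ξ s n, expansionRadius_pos hξ, ?_, ?_, ?_⟩
  · have := multipliableUniformlyOn_fPoly_pow (n := n) hξ hs 1
    simp only [pow_one] at this
    exact this
  · exact multipliableUniformlyOn_fPoly_pow hξ hs _
  · intro ω hω hω' hu
    -- For r = s + 1, `dropFirst` and `uParam` agree with the expressions in `Fin.tail` by
    -- definition.
    exact discriminant_eq_prod hξ hs hω hω' hu
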